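/- Let $\mathcal B$ be a unital $C^*$-algebra and let $\mathcal C$ be a (not necessarily unital) $C^*$-algebra. Let $E$ be a (right) Hilbert $\mathcal B$-module, $F$ a (right) Hilbert $\mathcal C$-module, and let $T\colon E\to F$ be a map. Write $\mathcal B^a(E,F)$ for the adjointable maps from $E$ to $F$, $\mathcal B^a(E)=\mathcal B^a(E,E)$, and $x^*\in E^*$ for the map $y\mapsto\langle x,y\rangle$. The extended linking algebra of $E$ is the $C^*$-algebra $\begin{pmatrix}\mathcal B&E^*\\E&\mathcal B^a(E)\end{pmatrix}\subset\mathcal B^a(\mathcal B\oplus E)$, and similarly for $F$ over $\mathcal C$; a map between these algebras is strict if it sends bounded strictly convergent nets to strictly convergent nets, where the strict topology is that of $\mathcal B^a(\mathcal B\oplus E)$ and of $\mathcal B^a(\mathcal C\oplus F)$ as multiplier algebras of the compact operators. Then the following conditions are equivalent: 1. $T$ admits a strict block-wise extension to a completely positive map $$\mathcal T=\begin{pmatrix}\tau&T^*\\T&\vartheta\end{pmatrix}\colon\begin{pmatrix}\mathcal B&E^*\\E&\mathcal B^a(E)\end{pmatrix}\longrightarrow\begin{pmatrix}\mathcal C&F^*\\F&\mathcal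 B^a(F)\end{pmatrix},$$ that is, there are maps $\tau\colon\mathcal B\to\mathcal C$ and $\vartheta\colon\mathcal B^a(E)\to\mathcal B^a(F)$ such that $\begin{pmatrix}b&x'^*\\x&a\end{pmatrix}\mapsto\begin{pmatrix}\tau(b)&T(x')^*\\T(x)&\vartheta(a)\end{pmatrix}$ is a strict completely positive (linear) map. 2. There exist a $\mathcal B$-$\mathcal C$-correspondence $\mathfrak F$ (a Hilbert $\mathcal C$-module with a nondegenerate left action of $\mathcal B$ by adjointable operators), an element $\xi_1\in\mathfrak F$ and a map $\xi_2\in\mathcal B^a(F,E\odot\mathfrak F)$, where $E\odot\mathfrak F$ is the interior tensor product over $\mathcal B$, such that $T(x)=\xi_2^*(x\odot\xi_1)$ for all $x\in E$. -/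

import Mathlib

universe u v w z

noncomputable section

namespace HilbertModule

/-!
A (right) Hilbert `B`-module is a complete `CStarModule Bᵐᵒᵖ E`. In Mathlib's class
`CStarModule A E` the algebra `A` acts from the left, with `⟨x, a • y⟩ = a * ⟨x, y⟩`; for `A = Bᵐᵒᵖ`
this is the right action `x b = op b • x` of `B`, and `ip B x y = unop (inner Bᵐᵒᵖ x y)` is the
`B`-valued inner product, which satisfies `⟨x, y b⟩ = ⟨x, y⟩ b`.
-/

open MulOpposite Filter Topology WithCStarModule
open scoped TensorProduct

set_option linter.unusedSectionVars false

section Adjointable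

variable {A : Type*} [NonUnitalCStarAlgebra A] [PartialOrder A] [StarOrderedRing A]
variable {E : Type*} [NormedAddCommGroup E] [NormedSpace ℂ E] [SMul A E] [CStarModule A E]
variable {F : Type*} [NormedAddCommGroup F] [NormedSpace ℂ F] [SMul A F] [CStarModule A F]
variable {G : Type*} [NormedAddCommGroup G] [NormedSpace ℂ G] [SMul A G] [CStarModule A G]

variable (A) in
theorem ext_inner {x y : E} (h : ∀ z : E, inner A z x = inner A z y) : x = y := by
  rw [← sub_eq_zero, ← CStarModule.inner_self (A := A), CStarModule.inner_sub_right, h, sub_self]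

variable (A) in
/-- `a : E → F` is adjointable with adjoint `a' : F → E`. (Maps which possess an adjoint are
automatically linear over the algebra, and bounded on complete modules.) -/
def IsAdjointPair (a : E →L[ℂ] F) (a' : F →L[ℂ] E) : Prop :=
  ∀ x y, inner A (a x) y = inner A x (a' y)

theorem IsAdjointPair.symm {a : E →L[ℂ] F} {a' : F →L[ℂ] E} (h : IsAdjointPair A a a') :
    IsAdjointPair A a' a := fun x y => by
  rw [← CStarModule.star_inner, ← h y x, CStarModule.star_inner]

theorem IsAdjointPair.unique {a : E →L[ℂ] F} {b c : F →L[ℂ] E} (hb : IsAdjointPair A a b)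
    (hc : IsAdjointPair A a c) : b = c := by
  ext y
  exact ext_inner A fun z => by rw [← hb, ← hc]

theorem IsAdjointPair.norm_sq_le {a : E →L[ℂ] F} {b : F →L[ℂ] E} (h : IsAdjointPair A a b) :
    ‖a‖ ^ 2 ≤ ‖b ∘L a‖ := by
  have key : ‖a‖ ≤ √‖b ∘L a‖ := by
    refine a.opNorm_le_bound (Real.sqrt_nonneg _) fun x => ?_
    refine abs_le_of_sq_le_sq' ?_ (by positivity) |>.2
    rw [CStarModule.norm_sq_eq A, h, mul_pow, Real.sq_sqrt (norm_nonneg _)]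
    calc _ ≤ ‖x‖ * ‖(b ∘L a) x‖ := CStarModule.norm_inner_le E
      _ ≤ ‖x‖ * (‖b ∘L a‖ * ‖x‖) := by gcongr; exact (b ∘L a).le_opNorm x
      _ = _ := by ring
  calc ‖a‖ ^ 2 ≤ √‖b ∘L a‖ ^ 2 := by gcongr
    _ = _ := Real.sq_sqrt (norm_nonneg _)

theorem IsAdjointPair.norm_le {a : E →L[ℂ] F} {b : F →L[ℂ] E} (h : IsAdjointPair A a b) :
    ‖a‖ ≤ ‖b‖ := by
  by_contra! hlt
  have h1 := h.norm_sq_le.trans (b.opNorm_comp_le a)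
  have : 0 < ‖a‖ := (norm_nonneg b).trans_lt hlt
  nlinarith

theorem IsAdjointPair.norm_eq {a : E →L[ℂ] F} {b : F →L[ℂ] E} (h : IsAdjointPair A a b) :
    ‖a‖ = ‖b‖ := le_antisymm h.norm_le h.symm.norm_le

variable (A E) in
/-- The algebra `𝓑ᵃ(E)` of adjointable operators on `E`. -/
def Adjointable : Subalgebra ℂ (E →L[ℂ] E) where
  carrier := {a | ∃ b, IsAdjointPair A a b}
  mul_mem' := by
    rintro a₁ a₂ ⟨b₁, h₁⟩ ⟨b₂, h₂⟩
    exact ⟨b₂ * b₁, fun x y => by simp [h₁ _ _, h₂ _ _]⟩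
  add_mem' := by
    rintro a₁ a₂ ⟨b₁, h₁⟩ ⟨b₂, h₂⟩
    exact ⟨b₁ + b₂, fun x y => by simp [h₁ _ _, h₂ _ _]⟩
  algebraMap_mem' c := ⟨algebraMap ℂ _ (star c), fun x y => by
    simp [Algebra.algebraMap_eq_smul_one]⟩

namespace Adjointable

theorem isAdjointPair_choose (a : Adjointable A E) :
    IsAdjointPair A (a : E →L[ℂ] E) a.2.choose := a.2.choose_spec

/-- The involution of `𝓑ᵃ(E)`: the adjoint. -/
instance : Star (Adjointable A E) where
  star a := ⟨a.2.choose, _, (isAdjointPair_choose a).symm⟩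

theorem isAdjointPair_star (a : Adjointable A E) :
    IsAdjointPair A (a : E →L[ℂ] E) (star a : Adjointable A E) := isAdjointPair_choose a

theorem star_eq_of_isAdjointPair {a b : Adjointable A E}
    (h : IsAdjointPair A (a : E →L[ℂ] E) (b : E →L[ℂ] E)) : star a = b :=
  Subtype.ext ((isAdjointPair_star a).unique h)

theorem inner_left (a : Adjointable A E) (x y : E) :
    inner A ((a : E →L[ℂ] E) x) y = inner A x (((star a : Adjointable A E) : E →L[ℂ] E) y) :=
  isAdjointPair_star a x y

instance : StarRing (Adjointable A E) where
  star_involutive a := star_eq_of_isAdjointPair (isAdjointPair_star a).symm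
  star_mul a b := star_eq_of_isAdjointPair fun x y => by
    simp [isAdjointPair_star a _ _, isAdjointPair_star b _ _]
  star_add a b := star_eq_of_isAdjointPair fun x y => by
    simp [isAdjointPair_star a _ _, isAdjointPair_star b _ _]

instance : StarModule ℂ (Adjointable A E) where
  star_smul c a := star_eq_of_isAdjointPair fun x y => by
    simp [isAdjointPair_star a _ _]

instance : CStarRing (Adjointable A E) where
  norm_mul_self_le a := by
    rw [← sq]
    exact (isAdjointPair_star a).norm_sq_le

theorem isClosed [CompleteSpace E] : IsClosed (Adjointable A E : Set (E →L[ℂ] E)) := by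
  refine isClosed_of_closure_subset fun a ha => ?_
  obtain ⟨s, hs, hlim⟩ := mem_closure_iff_seq_limit.1 ha
  choose t ht using hs
  have hc : CauchySeq t := by
    have := hlim.cauchySeq
    rw [Metric.cauchySeq_iff] at this ⊢
    intro ε hε
    obtain ⟨N, hN⟩ := this ε hε
    refine ⟨N, fun m hm n hn => ?_⟩
    have hp : IsAdjointPair A (s m - s n) (t m - t n) := fun x y => by
      simp [ht _ _ _]
    rw [dist_eq_norm, ← hp.norm_eq, ← dist_eq_norm]
    exact hN m hm n hn
  obtain ⟨b, hb⟩ := cauchySeq_tendsto_of_complete hc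
  refine ⟨b, fun x y => ?_⟩
  have h1 : Tendsto (fun n => inner A (s n x) y) atTop (𝓝 (inner A (a x) y)) :=
    ((CStarModule.continuous_inner (A := A) (E := E)).tendsto (a x, y)).comp
      (((ContinuousLinearMap.apply ℂ E x).continuous.tendsto a |>.comp hlim).prodMk_nhds
        tendsto_const_nhds)
  have h2 : Tendsto (fun n => inner A x (t n y)) atTop (𝓝 (inner A x (b y))) :=
    ((CStarModule.continuous_inner (A := A) (E := E)).tendsto (x, b y)).comp
      (tendsto_const_nhds.prodMk_nhds
        ((ContinuousLinearMap.apply ℂ E y).continuous.tendsto b |>.comp hb))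
  exact tendsto_nhds_unique (h1.congr fun n => ht n x y) h2

instance [CompleteSpace E] : CStarAlgebra (Adjointable A E) where
  toCompleteSpace := (isClosed (A := A) (E := E)).completeSpace_coe

end Adjointable

end Adjointable

section Self

variable {A : Type*} [NonUnitalCStarAlgebra A] [PartialOrder A] [StarOrderedRing A]

/-- A C⋆-algebra as a right Hilbert module over itself, with inner product `⟨x, y⟩ = x⋆ y`. -/
instance : CStarModule Aᵐᵒᵖ A where
  inner x y := op (star x * y)
  inner_add_right := by simp [mul_add]
  inner_self_nonneg := by
    intro x
    exact (star_mul_self_nonneg x : 0 ≤ star x * x)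
  inner_self := by
    intro x
    rw [op_eq_zero_iff, CStarRing.star_mul_self_eq_zero_iff]
  inner_op_smul_right := by
    intro a x y
    apply unop_injective
    simp [mul_assoc, MulOpposite.smul_eq_mul_unop]
  inner_smul_right_complex := by
    intro z x y
    apply unop_injective
    exact mul_smul_comm z (star x) y
  star_inner x y := by simp [← op_star]
  norm_eq_sqrt_norm_inner_self x := by
    rw [norm_op, CStarRing.norm_star_mul_self, Real.sqrt_mul_self (norm_nonneg x)]

end Self

section Completion

open UniformSpace

variable {A : Type*} [NonUnitalCStarAlgebra A] [PartialOrder A] [StarOrderedRing A]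
variable {P : Type*} [NormedAddCommGroup P] [NormedSpace ℂ P] [SMul A P] [CStarModule A P]

/-- The action of `a` as a linear map. -/
def smulₗ (a : A) : P →ₗ[ℂ] P where
  toFun y := a • y
  map_add' x y := ext_inner A fun z => by simp [mul_add]
  map_smul' c y := ext_inner A fun z => by simp [mul_smul_comm c a (inner A z y)]

@[simp] theorem smulₗ_apply (a : A) (y : P) : smulₗ a y = a • y := rfl

theorem norm_smul_le' (a : A) (x : P) : ‖a • x‖ ≤ ‖a‖ * ‖x‖ := by
  refine abs_le_of_sq_le_sq' ?_ (by positivity) |>.2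
  rw [CStarModule.norm_sq_eq A, CStarModule.inner_op_smul_right, CStarModule.inner_op_smul_left,
    mul_pow, CStarModule.norm_sq_eq A (x := x)]
  calc _ ≤ ‖a‖ * (‖inner A x x‖ * ‖star a‖) :=
        (norm_mul_le _ _).trans (by gcongr; exact norm_mul_le _ _)
    _ = _ := by rw [norm_star]; ring

theorem uniformContinuousConstSMul : UniformContinuousConstSMul A P where
  uniformContinuous_const_smul a :=
    (AddMonoidHomClass.lipschitz_of_bound (smulₗ a : P →ₗ[ℂ] P) ‖a‖
      fun x => norm_smul_le' a x).uniformContinuous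

namespace Completion

theorem inner_coe' (p q : P) :
    inner A (p : Completion P) (q : Completion P) = inner A p q :=
  (Completion.isDenseInducing_coe.prodMap Completion.isDenseInducing_coe).extend_eq
    (CStarModule.continuous_inner : Continuous (Function.uncurry (inner A (E := P)))) (p, q)

theorem continuous_uncurry_inner :
    Continuous (Function.uncurry (inner A (E := Completion P))) := by
  let inner' : P →+ P →+ A :=
    { toFun := fun x => (CStarModule.innerₛₗ (A := A) x).toAddMonoidHom
      map_zero' := by ext x; exact CStarModule.inner_zero_left (A := A)
      map_add' := fun x y => by ext z; exact CStarModule.inner_add_left (A := A) }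
  have : Continuous fun p : P × P => inner' p.1 p.2 := CStarModule.continuous_inner (A := A)
  exact (Completion.isDenseInducing_toCompl P).extend_Z_bilin
    (Completion.isDenseInducing_toCompl P) this

theorem continuous_inner' {X : Type*} [TopologicalSpace X] {f g : X → Completion P}
    (hf : Continuous f) (hg : Continuous g) : Continuous fun x => inner A (f x) (g x) :=
  continuous_uncurry_inner.comp (hf.prodMk hg)

theorem norm_eq' (x : Completion P) : ‖x‖ = √‖inner A x x‖ :=
  Completion.induction_on x
    (isClosed_eq continuous_norm (continuous_inner' continuous_id continuous_id).norm.sqrt)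
    fun a => by
      rw [inner_coe', Completion.norm_coe, CStarModule.norm_eq_sqrt_norm_inner_self (A := A)]

/-- The completion of a pre-Hilbert module is a Hilbert module. -/
instance [UniformContinuousConstSMul A P] : CStarModule A (Completion P) where
  inner_add_right {x y z} :=
    Completion.induction_on₃ x y z
      (isClosed_eq (continuous_inner' (by fun_prop) (by fun_prop))
        ((continuous_inner' (by fun_prop) (by fun_prop)).add
          (continuous_inner' (by fun_prop) (by fun_prop))))
      fun a b c => by
        rw [← Completion.coe_add, inner_coe', inner_coe', inner_coe', CStarModule.inner_add_right]
  inner_self_nonneg {x} :=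
    Completion.induction_on x
      (CStarAlgebra.isClosed_nonneg.preimage (continuous_inner' continuous_id continuous_id))
      fun a => by
        rw [inner_coe']
        exact CStarModule.inner_self_nonneg
  inner_self {x} := by
    refine ⟨fun h => norm_eq_zero.1 (by rw [norm_eq' (A := A), h, norm_zero, Real.sqrt_zero]), ?_⟩
    rintro rfl
    rw [← norm_eq_zero, ← Real.sqrt_eq_zero (norm_nonneg _), ← norm_eq', norm_zero]
  inner_op_smul_right {a x y} :=
    Completion.induction_on₂ x y
      (isClosed_eq (continuous_inner' (by fun_prop)
          ((uniformContinuous_const_smul a).continuous.comp continuous_snd))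
        (continuous_const.mul (continuous_inner' (by fun_prop) (by fun_prop))))
      fun p q => by
        rw [← Completion.coe_smul, inner_coe', inner_coe', CStarModule.inner_op_smul_right]
  inner_smul_right_complex {c x y} :=
    Completion.induction_on₂ x y
      (isClosed_eq (continuous_inner' continuous_fst (continuous_snd.const_smul c))
        ((continuous_inner' continuous_fst continuous_snd).const_smul c))
      fun p q => by
        rw [← Completion.coe_smul, inner_coe', inner_coe', CStarModule.inner_smul_right_complex]
  star_inner x y :=
    Completion.induction_on₂ x y
      (isClosed_eq (continuous_inner' continuous_fst continuous_snd).star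
        (continuous_inner' continuous_snd continuous_fst))
      fun p q => by rw [inner_coe', inner_coe', CStarModule.star_inner]
  norm_eq_sqrt_norm_inner_self x := norm_eq' x

end Completion

end Completion

section Tensor

variable {B : Type*} [NonUnitalCStarAlgebra B] [PartialOrder B] [StarOrderedRing B]
variable {E : Type*} [NormedAddCommGroup E] [NormedSpace ℂ E] [SMul Bᵐᵒᵖ E] [CStarModule Bᵐᵒᵖ E]

variable (B) in
/-- The `B`-valued inner product `⟨x, y⟩` of a right Hilbert `B`-module, conjugate linear in `x`
and right `B`-linear in `y`. -/
def ip (x y : E) : B := unop (inner Bᵐᵒᵖ x y)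

theorem star_ip (x y : E) : star (ip B x y) = ip B y x := by
  apply op_injective
  rw [ip, ip, op_star, op_unop, op_unop, CStarModule.star_inner]

theorem ip_smul_right (x y : E) (b : B) : ip B x (op b • y) = ip B x y * b := by
  apply op_injective
  simp [ip]

theorem ip_smul_left (x y : E) (b : B) : ip B (op b • x) y = star b * ip B x y := by
  rw [← star_ip, ip_smul_right, star_mul, star_ip]

variable (B E) in
/-- The inner product as a sesquilinear map. -/
def ipₛₗ : E →ₗ⋆[ℂ] E →ₗ[ℂ] B :=
  (CStarModule.innerₛₗ (A := Bᵐᵒᵖ) (E := E)).compr₂ₛₗ (opLinearEquiv ℂ).symm.toLinearMap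

@[simp] theorem ipₛₗ_apply (x y : E) : ipₛₗ B E x y = ip B x y := rfl

theorem ip_self_nonneg (x : E) : 0 ≤ ip B x x :=
  (CStarModule.inner_self_nonneg (A := Bᵐᵒᵖ) : 0 ≤ inner Bᵐᵒᵖ x x)

theorem exists_negPart {D : Type*} [NonUnitalCStarAlgebra D] [PartialOrder D] [StarOrderedRing D]
    (M : D) (hM : IsSelfAdjoint M) : ∃ P R : D, star P = P ∧ P = star R * R ∧
      P * M * P = - (star (R * P) * (R * P)) ∧ (P = 0 → ∃ S, M = star S * S) := by
  have hP : 0 ≤ M⁻ := CFC.negPart_nonneg M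
  obtain ⟨R, hR⟩ := CStarAlgebra.nonneg_iff_eq_star_mul_self.1 hP
  have hPs : star M⁻ = M⁻ := (IsSelfAdjoint.of_nonneg hP).star_eq
  refine ⟨M⁻, R, hPs, hR, ?_, fun h => ?_⟩
  · have : M = M⁺ - M⁻ := (CFC.posPart_sub_negPart M hM).symm
    calc M⁻ * M * M⁻ = M⁻ * (M⁺ - M⁻) * M⁻ := by rw [← this]
      _ = - (M⁻ * M⁻ * M⁻) := by simp [mul_sub, CFC.negPart_mul_posPart]
      _ = - (M⁻ * (star R * R) * M⁻) := by rw [← hR]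
      _ = _ := by rw [star_mul, hPs]; simp only [mul_assoc]
  · apply CStarAlgebra.nonneg_iff_eq_star_mul_self.1
    rw [← CFC.posPart_sub_negPart M hM, h, sub_zero]
    exact CFC.posPart_nonneg M

/-- The Gram matrix of finitely many elements of a Hilbert module is positive. -/
theorem gram_nonneg {ι : Type*} [Fintype ι] (x : ι → E) :
    ∃ S : CStarMatrix ι ι B, ∀ i j, ip B (x i) (x j) = ∑ k, star (S k i) * S k j := by
  let M : CStarMatrix ι ι B := CStarMatrix.ofMatrix fun i j => ip B (x i) (x j)
  have hMa (i j : ι) : M i j = ip B (x i) (x j) := rfl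
  have hM : IsSelfAdjoint M := by
    ext i j
    rw [CStarMatrix.star_apply, hMa, hMa, star_ip]
  obtain ⟨P, R, hPs, hR, h1, hS⟩ := exists_negPart M hM
  have h2 (k : ι) : 0 ≤ (P * M * P) k k := by
    have : (P * M * P) k k = ip B (∑ i, op (P i k) • x i) (∑ i, op (P i k) • x i) := by
      rw [← ipₛₗ_apply]
      simp only [map_sum, LinearMap.sum_apply, ipₛₗ_apply, ip_smul_left, ip_smul_right,
        CStarMatrix.mul_apply, Finset.sum_mul]
      refine Finset.sum_congr rfl fun j _ => Finset.sum_congr rfl fun i _ => ?_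
      rw [← CStarMatrix.star_apply, hPs, hMa, mul_assoc]
    rw [this]
    exact ip_self_nonneg _
  have h3 (k i : ι) : (R * P) i k = 0 := by
    have h4 : ∑ i, star ((R * P) i k) * (R * P) i k = 0 := by
      refine le_antisymm ?_ (Finset.sum_nonneg fun i _ => star_mul_self_nonneg _)
      have := h2 k
      rw [h1, CStarMatrix.neg_apply, CStarMatrix.mul_apply] at this
      simpa only [CStarMatrix.star_apply, Left.nonneg_neg_iff] using this
    rw [Finset.sum_eq_zero_iff_of_nonneg fun i _ => star_mul_self_nonneg _] at h4
    exact (CStarRing.star_mul_self_eq_zero_iff _).1 (h4 i (Finset.mem_univ i))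
  have h5 : R * P = 0 := by ext i k; exact h3 k i
  have h6 : P = 0 := by
    rw [← CStarRing.star_mul_self_eq_zero_iff, hPs]
    nth_rewrite 1 [hR]
    rw [mul_assoc, h5, mul_zero]
  obtain ⟨S, hS⟩ := hS h6
  refine ⟨S, fun i j => ?_⟩
  rw [← hMa, hS, CStarMatrix.mul_apply]
  simp only [CStarMatrix.star_apply]

variable {A : Type*} [NonUnitalCStarAlgebra A] [PartialOrder A] [StarOrderedRing A]
variable {G : Type*} [NormedAddCommGroup G] [NormedSpace ℂ G] [SMul A G] [CStarModule A G]

variable (E) in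
/-- The semi-inner product on the algebraic tensor product `E ⊗ G` which is determined by
`⟨x ⊗ y, x' ⊗ y'⟩ = ⟨y, φ(⟨x, x'⟩) y'⟩`. -/
def tensorForm (φ : B →⋆ₙₐ[ℂ] Adjointable A G) : (E ⊗[ℂ] G) →ₗ⋆[ℂ] (E ⊗[ℂ] G) →ₗ[ℂ] A :=
  TensorProduct.lift <| LinearMap.mk₂'ₛₗ (starRingEnd ℂ) (starRingEnd ℂ)
    (fun x y => TensorProduct.lift <| LinearMap.mk₂ ℂ
      (fun x' y' => inner A y ((φ (ip B x x') : G →L[ℂ] G) y'))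
      (fun x₁ x₂ y' => by simp [← ipₛₗ_apply])
      (fun c x' y' => by simp [← ipₛₗ_apply])
      (fun x' y₁ y₂ => by simp)
      (fun c x' y' => by simp))
    (fun x₁ x₂ y => TensorProduct.ext' fun x' y' => by simp [← ipₛₗ_apply])
    (fun c x y => TensorProduct.ext' fun x' y' => by simp [← ipₛₗ_apply])
    (fun x y₁ y₂ => TensorProduct.ext' fun x' y' => CStarModule.inner_add_left)
    (fun c x y => TensorProduct.ext' fun x' y' => CStarModule.inner_smul_left_complex)

variable (φ : B →⋆ₙₐ[ℂ] Adjointable A G)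

@[simp] theorem tensorForm_tmul (x x' : E) (y y' : G) :
    tensorForm E φ (x ⊗ₜ y) (x' ⊗ₜ y') = inner A y ((φ (ip B x x') : G →L[ℂ] G) y') := rfl

theorem star_tensorForm (t s : E ⊗[ℂ] G) : star (tensorForm E φ t s) = tensorForm E φ s t := by
  induction t with
  | zero => simp
  | add a b ha hb => simp [ha, hb]
  | tmul x y =>
    induction s with
    | zero => simp
    | add a b ha hb => simp [ha, hb]
    | tmul x' y' =>
      rw [tensorForm_tmul, tensorForm_tmul, CStarModule.star_inner, Adjointable.inner_left,
        ← map_star, star_ip]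

theorem tensorForm_self_nonneg (t : E ⊗[ℂ] G) : 0 ≤ tensorForm E φ t t := by
  obtain ⟨s, rfl⟩ := TensorProduct.exists_finset t
  obtain ⟨S, hS⟩ := gram_nonneg (B := B) fun i : s => (i : E × G).1
  have : tensorForm E φ (∑ i ∈ s, i.1 ⊗ₜ i.2) (∑ i ∈ s, i.1 ⊗ₜ i.2) =
      ∑ k : s, inner A (∑ i : s, (φ (S k i) : G →L[ℂ] G) (i : E × G).2)
        (∑ i : s, (φ (S k i) : G →L[ℂ] G) (i : E × G).2) := by
    rw [← Finset.sum_coe_sort s]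
    simp only [map_sum, LinearMap.sum_apply, tensorForm_tmul, hS, CStarModule.inner_sum_right,
      CStarModule.inner_sum_left, AddSubmonoidClass.coe_finsetSum,
      sum_apply, map_mul, map_star, MulMemClass.coe_mul,
      mul_apply_eq_comp, Adjointable.inner_left]
    conv_lhs =>
      enter [2, x]
      rw [Finset.sum_comm]
    rw [Finset.sum_comm]
  rw [this]
  exact Finset.sum_nonneg fun k _ => CStarModule.inner_self_nonneg

theorem tensorForm_smul (a : A) (t s : E ⊗[ℂ] G) :
    tensorForm E φ t ((smulₗ a).lTensor E s) = a * tensorForm E φ t s := by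
  induction t with
  | zero => simp
  | add a b ha hb => simp [ha, hb, mul_add]
  | tmul x y =>
    induction s with
    | zero => simp
    | add a b ha hb => simp [ha, hb, mul_add]
    | tmul x' y' =>
      rw [LinearMap.lTensor_tmul, tensorForm_tmul, tensorForm_tmul, smulₗ_apply,
        ← star_star (φ _), ← Adjointable.inner_left, ← Adjointable.inner_left,
        CStarModule.inner_op_smul_right]

variable (E) in
/-- The null space of the semi-inner product on `E ⊗ G`. -/
def tensorNull : Submodule ℂ (E ⊗[ℂ] G) where
  carrier := {s | ∀ t, tensorForm E φ t s = 0}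
  add_mem' ha hb t := by rw [map_add, ha, hb, add_zero]
  zero_mem' t := map_zero _
  smul_mem' c a ha t := by rw [map_smul, ha, smul_zero]

/-- A vector of length zero is orthogonal to everything. -/
theorem mem_tensorNull_of_self {s : E ⊗[ℂ] G} (hs : tensorForm E φ s s = 0) :
    s ∈ tensorNull E φ := by
  intro t
  set c := tensorForm E φ t s with hc
  have hc' : tensorForm E φ s t = star c := by rw [hc, star_tensorForm]
  have h1 : tensorForm E φ t ((smulₗ (star c)).lTensor E s) = star c * c := tensorForm_smul ..
  have h2 : tensorForm E φ ((smulₗ (star c)).lTensor E s) t = star c * c := by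
    rw [← star_tensorForm, h1, star_mul, star_star]
  have h3 : tensorForm E φ ((smulₗ (star c)).lTensor E s) ((smulₗ (star c)).lTensor E s) = 0 := by
    rw [tensorForm_smul, ← star_tensorForm, tensorForm_smul, hs, mul_zero, star_zero, mul_zero]
  have key (n : ℕ) : n • (star c * c) ≤ tensorForm E φ t t := by
    have h := tensorForm_self_nonneg φ (t - n • (smulₗ (star c)).lTensor E s)
    simp only [map_sub, map_nsmul, LinearMap.sub_apply, LinearMap.smul_apply, h1, h2, h3] at h
    have h4 : 0 ≤ n • (star c * c) := nsmul_nonneg (star_mul_self_nonneg c) n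
    rw [smul_zero, sub_zero, sub_sub, ← sub_nonneg.symm] at h
    exact le_trans (le_add_of_nonneg_left h4) h
  have hn (n : ℕ) : (n : ℝ) * ‖star c * c‖ ≤ ‖tensorForm E φ t t‖ := by
    have := CStarAlgebra.norm_le_norm_of_nonneg_of_le
      (nsmul_nonneg (star_mul_self_nonneg c) n) (key n)
    rwa [← Nat.cast_smul_eq_nsmul ℂ, norm_smul, Complex.norm_natCast] at this
  by_contra hne
  have hpos : 0 < ‖star c * c‖ :=
    norm_pos_iff.2 fun h => hne ((CStarRing.star_mul_self_eq_zero_iff c).1 h)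
  obtain ⟨n, hn'⟩ := exists_nat_gt (‖tensorForm E φ t t‖ / ‖star c * c‖)
  rw [div_lt_iff₀ hpos] at hn'
  exact absurd (hn n) (not_le.2 hn')

variable (E) in
/-- The quotient of the algebraic tensor product by the null space. -/
def PreTensor : Type _ := (E ⊗[ℂ] G) ⧸ tensorNull E φ

namespace PreTensor

instance : AddCommGroup (PreTensor E φ) := inferInstanceAs (AddCommGroup (_ ⧸ tensorNull E φ))
instance : Module ℂ (PreTensor E φ) := inferInstanceAs (Module ℂ (_ ⧸ tensorNull E φ))

variable (E) in
/-- The quotient map. -/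
def mk : E ⊗[ℂ] G →ₗ[ℂ] PreTensor E φ := (tensorNull E φ).mkQ

theorem mk_surjective : Function.Surjective (mk E φ) := (tensorNull E φ).mkQ_surjective

instance : SMul A (PreTensor E φ) where
  smul a := (tensorNull E φ).mapQ (tensorNull E φ) ((smulₗ a).lTensor E) fun s hs t => by
    rw [tensorForm_smul, hs, mul_zero]

theorem smul_mk (a : A) (t : E ⊗[ℂ] G) : a • mk E φ t = mk E φ ((smulₗ a).lTensor E t) := rfl

/-- The inner product of the quotient. -/
def form (p q : PreTensor E φ) : A :=
  (tensorNull E φ).liftQ (LinearMap.flip <| (tensorNull E φ).liftQ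
      (LinearMap.flip (tensorForm E φ)) fun s hs => LinearMap.ext fun t => hs t)
    (fun s hs => LinearMap.ext fun q => by
      obtain ⟨t, rfl⟩ := mk_surjective φ q
      change tensorForm E φ s t = 0
      rw [← star_tensorForm, hs, star_zero]) p q

theorem form_mk (s t : E ⊗[ℂ] G) : form φ (mk E φ s) (mk E φ t) = tensorForm E φ s t := rfl

instance : Norm (PreTensor E φ) where
  norm x := √‖form φ x x‖

instance : CStarModule A (PreTensor E φ) where
  inner := form φ
  inner_add_right {x y z} := by
    obtain ⟨x, rfl⟩ := mk_surjective φ x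
    obtain ⟨y, rfl⟩ := mk_surjective φ y
    obtain ⟨z, rfl⟩ := mk_surjective φ z
    rw [← map_add, form_mk, form_mk, form_mk, map_add]
  inner_self_nonneg {x} := by
    obtain ⟨x, rfl⟩ := mk_surjective φ x
    exact tensorForm_self_nonneg φ x
  inner_self {x} := by
    obtain ⟨x, rfl⟩ := mk_surjective φ x
    refine ⟨fun h => (Submodule.Quotient.mk_eq_zero _).2 (mem_tensorNull_of_self φ h), fun h => ?_⟩
    exact (Submodule.Quotient.mk_eq_zero (tensorNull E φ)).1 h x
  inner_op_smul_right {a x y} := by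
    obtain ⟨x, rfl⟩ := mk_surjective φ x
    obtain ⟨y, rfl⟩ := mk_surjective φ y
    exact tensorForm_smul φ a x y
  inner_smul_right_complex {c x y} := by
    obtain ⟨x, rfl⟩ := mk_surjective φ x
    obtain ⟨y, rfl⟩ := mk_surjective φ y
    rw [← map_smul, form_mk, form_mk, map_smul]
  star_inner x y := by
    obtain ⟨x, rfl⟩ := mk_surjective φ x
    obtain ⟨y, rfl⟩ := mk_surjective φ y
    exact star_tensorForm φ x y
  norm_eq_sqrt_norm_inner_self x := rfl

instance : NormedAddCommGroup (PreTensor E φ) := CStarModule.normedAddCommGroup A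
instance : NormedSpace ℂ (PreTensor E φ) := .ofCore (CStarModule.normedSpaceCore A)

theorem inner_mk (s t : E ⊗[ℂ] G) : inner A (mk E φ s) (mk E φ t) = tensorForm E φ s t := rfl

end PreTensor

instance : UniformContinuousConstSMul A (PreTensor E φ) := uniformContinuousConstSMul

variable (E) in
/-- The interior tensor product `E ⊙ G` of a right Hilbert `B`-module `E` and a Hilbert module `G`
with left action `φ` of `B`: the Hausdorff completion of the algebraic tensor product with respect
to the inner product determined by `⟨x ⊗ y, x' ⊗ y'⟩ = ⟨y, φ(⟨x, x'⟩) y'⟩`. -/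
abbrev InteriorTensor : Type _ := UniformSpace.Completion (PreTensor E φ)

namespace InteriorTensor

/-- The elementary tensor `x ⊙ y`. -/
def tmul (x : E) (y : G) : InteriorTensor E φ := (PreTensor.mk E φ (x ⊗ₜ y) : PreTensor E φ)

theorem inner_tmul (x x' : E) (y y' : G) :
    inner A (tmul φ x y) (tmul φ x' y') = inner A y ((φ (ip B x x') : G →L[ℂ] G) y') :=
  Completion.inner_coe' ..

end InteriorTensor

end Tensor

section Linking

variable {C : Type*} [NonUnitalCStarAlgebra C] [PartialOrder C] [StarOrderedRing C]
variable {F : Type*} [NormedAddCommGroup F] [NormedSpace ℂ F] [SMul Cᵐᵒᵖ F] [CStarModule Cᵐᵒᵖ F]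
variable {F' : Type*} [NormedAddCommGroup F'] [NormedSpace ℂ F'] [SMul Cᵐᵒᵖ F']
  [CStarModule Cᵐᵒᵖ F']

variable (C) in
/-- The operator `y⋆ : F → C`, `x ↦ ⟨y, x⟩`. -/
def bra (y : F) : F →L[ℂ] C :=
  (opContinuousLinearEquiv ℂ).symm.toContinuousLinearMap ∘L CStarModule.innerSL (A := Cᵐᵒᵖ) y

@[simp] theorem bra_apply (y x : F) : bra C y x = ip C y x := rfl

variable (C) in
/-- The operator `C → F`, `c ↦ z c`. -/
def ket (z : F) : C →L[ℂ] F :=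
  LinearMap.mkContinuous
    { toFun := fun c => op c • z
      map_add' := fun c d => ext_inner Cᵐᵒᵖ fun w => by simp [add_mul]
      map_smul' := fun r c => ext_inner Cᵐᵒᵖ fun w => by simp [smul_mul_assoc r (op c)] }
    ‖z‖ fun c => (norm_smul_le' (op c) z).trans_eq (by rw [norm_op, mul_comm])

@[simp] theorem ket_apply (z : F) (c : C) : ket C z c = op c • z := rfl

theorem ip_ket (z : F) (c : C) (x : F) : ip C (ket C z c) x = star c * ip C z x :=
  ip_smul_left z x c

variable (C) in
/-- The rank-one operator `z y⋆ : x ↦ z ⟨y, x⟩`. -/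
def rankOne (z y : F) : Adjointable Cᵐᵒᵖ F :=
  ⟨ket C z ∘L bra C y, ket C y ∘L bra C z, fun u v => by
    apply unop_injective
    change ip C (op (ip C y u) • z) v = ip C u (op (ip C z v) • y)
    rw [ip_smul_left, ip_smul_right, star_ip]⟩

variable (C F) in
/-- The C⋆-algebra `𝓚(F)` of compact operators, the closed linear span of the rank-one operators,
as a subset of `𝓑ᵃ(F)`. -/
def compacts : Submodule ℂ (Adjointable Cᵐᵒᵖ F) :=
  (Submodule.span ℂ {a | ∃ z y, a = rankOne C z y}).topologicalClosure

variable (C) in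
/-- Convergence along `l` of the family `u` in `𝓑ᵃ(F)` to `a` in the strict topology, that is, the
topology of `𝓑ᵃ(F)` as the multiplier algebra of `𝓚(F)`. -/
def TendstoStrictly {ι : Type*} (u : ι → Adjointable Cᵐᵒᵖ F) (l : Filter ι)
    (a : Adjointable Cᵐᵒᵖ F) : Prop :=
  ∀ k ∈ compacts C F, Tendsto (fun i => u i * k) l (𝓝 (a * k)) ∧
    Tendsto (fun i => k * u i) l (𝓝 (k * a))

variable (C F) in
/-- The Hilbert module `C ⊕ F`, with inner product `⟨(c, x), (d, y)⟩ = c⋆ d + ⟨x, y⟩`. -/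
abbrev Column : Type _ := C⋆ᵐᵒᵈ(Cᵐᵒᵖ, C × F)

/-- The action of the block matrix `[[c, y⋆], [z, a]]` on `C ⊕ F`. -/
def blockCLM (c : C) (y z : F) (a : F →L[ℂ] F) : Column C F →L[ℂ] Column C F :=
  (equivL (A := Cᵐᵒᵖ) (E := C × F) ℂ).symm.toContinuousLinearMap ∘L
    (((ContinuousLinearMap.mul ℂ C c).coprod (bra C y)).prod ((ket C z).coprod a)) ∘L
      (equivL (A := Cᵐᵒᵖ) (E := C × F) ℂ).toContinuousLinearMap

theorem blockCLM_fst (c : C) (y z : F) (a : F →L[ℂ] F) (v : Column C F) :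
    (blockCLM c y z a v).1 = c * v.1 + ip C y v.2 := rfl

theorem blockCLM_snd (c : C) (y z : F) (a : F →L[ℂ] F) (v : Column C F) :
    (blockCLM c y z a v).2 = op v.1 • z + a v.2 := rfl

theorem ip_column (v w : Column C F) : ip C v w = star v.1 * w.1 + ip C v.2 w.2 := rfl

theorem ip_add_left (x y z : F) : ip C (x + y) z = ip C x z + ip C y z := by
  simp [← ipₛₗ_apply]

theorem ip_add_right (x y z : F) : ip C x (y + z) = ip C x y + ip C x z := by
  simp [← ipₛₗ_apply]

theorem isAdjointPair_iff {a : F →L[ℂ] F'} {b : F' →L[ℂ] F} :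
    IsAdjointPair Cᵐᵒᵖ a b ↔ ∀ x y, ip C (a x) y = ip C x (b y) :=
  forall₂_congr fun _ _ => unop_injective.eq_iff.symm

theorem isAdjointPair_blockCLM (c : C) (y z : F) {a b : F →L[ℂ] F} (h : IsAdjointPair Cᵐᵒᵖ a b) :
    IsAdjointPair Cᵐᵒᵖ (blockCLM c y z a) (blockCLM (star c) z y b) := by
  rw [isAdjointPair_iff] at h ⊢
  intro v w
  simp only [ip_column, blockCLM_fst, blockCLM_snd, ip_add_left, ip_add_right, h, ip_smul_left,
    ip_smul_right, star_add, star_mul, star_ip, add_mul, mul_add, mul_assoc]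
  abel

/-- The block matrix `[[c, y⋆], [z, a]]` with `c ∈ C`, `y, z ∈ F` and `a ∈ 𝓑ᵃ(F)`, as an adjointable
operator on `C ⊕ F`. -/
def block (c : C) (y z : F) (a : Adjointable Cᵐᵒᵖ F) : Adjointable Cᵐᵒᵖ (Column C F) :=
  ⟨blockCLM c y z a, _, isAdjointPair_blockCLM c y z (Adjointable.isAdjointPair_star a)⟩

theorem column_ext {v w : Column C F} (h₁ : v.1 = w.1) (h₂ : v.2 = w.2) : v = w :=
  (equiv Cᵐᵒᵖ (C × F)).injective (Prod.ext h₁ h₂)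

theorem block_ext {X Y : Adjointable Cᵐᵒᵖ (Column C F)}
    (h₁ : ∀ v, ((X : Column C F →L[ℂ] Column C F) v).1 = ((Y : Column C F →L[ℂ] Column C F) v).1)
    (h₂ : ∀ v, ((X : Column C F →L[ℂ] Column C F) v).2 = ((Y : Column C F →L[ℂ] Column C F) v).2) :
    X = Y :=
  Subtype.ext (ContinuousLinearMap.ext fun v => column_ext (h₁ v) (h₂ v))

theorem star_block (c : C) (y z : F) (a : Adjointable Cᵐᵒᵖ F) :
    star (block c y z a) = block (star c) z y (star a) :=
  Adjointable.star_eq_of_isAdjointPair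
    (isAdjointPair_blockCLM c y z (Adjointable.isAdjointPair_star a))

theorem block_add (c c' : C) (y y' z z' : F) (a a' : Adjointable Cᵐᵒᵖ F) :
    block c y z a + block c' y' z' a' = block (c + c') (y + y') (z + z') (a + a') := by
  refine block_ext (fun v => ?_) fun v => ?_
  · change (c * v.1 + ip C y v.2) + (c' * v.1 + ip C y' v.2) = _
    rw [block, blockCLM_fst, ip_add_left, add_mul]
    abel
  · change (op v.1 • z + (a : F →L[ℂ] F) v.2) + (op v.1 • z' + (a' : F →L[ℂ] F) v.2) = _
    rw [block, blockCLM_snd, ← smulₗ_apply (op v.1) (z + z'), map_add]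
    simp only [smulₗ_apply, Subalgebra.coe_add, _root_.add_apply]
    abel

theorem smul_block (r : ℂ) (c : C) (y z : F) (a : Adjointable Cᵐᵒᵖ F) :
    r • block c y z a = block (r • c) (star r • y) (r • z) (r • a) := by
  refine block_ext (fun v => ?_) fun v => ?_
  · change r • (c * v.1 + ip C y v.2) = (r • c) * v.1 + ip C (star r • y) v.2
    refine (smul_add r _ _).trans (congrArg₂ (· + ·) (smul_mul_assoc r c _).symm ?_)
    simp [← ipₛₗ_apply]
  · change r • (op v.1 • z + (a : F →L[ℂ] F) v.2) = op v.1 • (r • z) + r • (a : F →L[ℂ] F) v.2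
    rw [← smulₗ_apply _ (r • z), map_smul, smul_add, smulₗ_apply]

theorem ip_star_apply (a : Adjointable Cᵐᵒᵖ F) (x y : F) :
    ip C (((star a : Adjointable Cᵐᵒᵖ F) : F →L[ℂ] F) x) y = ip C x ((a : F →L[ℂ] F) y) :=
  isAdjointPair_iff.1 (Adjointable.isAdjointPair_star a).symm x y

theorem smul_op_smul (c d : C) (z : F) : op d • op c • z = op (c * d) • z :=
  ext_inner Cᵐᵒᵖ fun w => by simp [mul_assoc]

theorem map_op_smul (a : Adjointable Cᵐᵒᵖ F) (c : C) (z : F) :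
    (a : F →L[ℂ] F) (op c • z) = op c • (a : F →L[ℂ] F) z :=
  ext_inner Cᵐᵒᵖ fun w => by
    rw [← (Adjointable.isAdjointPair_star a).symm, CStarModule.inner_op_smul_right,
      CStarModule.inner_op_smul_right, ← (Adjointable.isAdjointPair_star a).symm]

theorem block_mul (c c' : C) (y y' z z' : F) (a a' : Adjointable Cᵐᵒᵖ F) :
    block c y z a * block c' y' z' a' =
      block (c * c' + ip C y z') (op (star c) • y' + ((star a' : Adjointable Cᵐᵒᵖ F) : F →L[ℂ] F) y)
        (op c' • z + (a : F →L[ℂ] F) z') (rankOne C z y' + a * a') := by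
  refine block_ext (fun v => ?_) fun v => ?_
  · change c * (c' * v.1 + ip C y' v.2) + ip C y (op v.1 • z' + (a' : F →L[ℂ] F) v.2) =
      (c * c' + ip C y z') * v.1 +
        ip C (op (star c) • y' + ((star a' : Adjointable Cᵐᵒᵖ F) : F →L[ℂ] F) y) v.2
    rw [ip_add_left, ip_add_right, ip_smul_left, ip_smul_right, ip_star_apply, star_star, mul_add,
      add_mul, mul_assoc]
    abel
  · change op (c' * v.1 + ip C y' v.2) • z +
        (a : F →L[ℂ] F) (op v.1 • z' + (a' : F →L[ℂ] F) v.2) =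
      op v.1 • (op c' • z + (a : F →L[ℂ] F) z') +
        (op (ip C y' v.2) • z + (a : F →L[ℂ] F) ((a' : F →L[ℂ] F) v.2))
    rw [← ket_apply z (c' * v.1 + _), map_add, map_add, map_op_smul, ket_apply, ket_apply,
      ← smulₗ_apply (op v.1) (op c' • z + _), map_add, smulₗ_apply, smulₗ_apply, smul_op_smul]
    abel

variable (C F) in
/-- The extended linking algebra `[[C, F⋆], [F, 𝓑ᵃ(F)]]`, acting on `C ⊕ F`. -/
def linkingSubalgebra : NonUnitalStarSubalgebra ℂ (Adjointable Cᵐᵒᵖ (Column C F)) where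
  carrier := {X | ∃ c y z a, X = block c y z a}
  add_mem' := by
    rintro _ _ ⟨c, y, z, a, rfl⟩ ⟨c', y', z', a', rfl⟩
    exact ⟨_, _, _, _, block_add ..⟩
  zero_mem' := ⟨0, 0, 0, 0, by
    simpa only [zero_smul, star_zero] using smul_block 0 (0 : C) (0 : F) 0 0⟩
  mul_mem' := by
    rintro _ _ ⟨c, y, z, a, rfl⟩ ⟨c', y', z', a', rfl⟩
    exact ⟨_, _, _, _, block_mul ..⟩
  smul_mem' := by
    rintro r _ ⟨c, y, z, a, rfl⟩
    exact ⟨_, _, _, _, smul_block ..⟩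
  star_mem' := by
    rintro _ ⟨c, y, z, a, rfl⟩
    exact ⟨_, _, _, _, star_block ..⟩

theorem norm_bra (y : F) : ‖bra C y‖ = ‖y‖ := by
  refine le_antisymm (ContinuousLinearMap.opNorm_le_bound _ (norm_nonneg _) fun x => ?_) ?_
  · exact CStarModule.norm_inner_le (A := Cᵐᵒᵖ) F
  · have h : ‖y‖ ^ 2 ≤ ‖bra C y‖ * ‖y‖ := by
      rw [CStarModule.norm_sq_eq Cᵐᵒᵖ]
      exact (bra C y).le_opNorm y
    rcases (norm_nonneg y).eq_or_lt with h0 | h0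
    · rw [← h0]; exact norm_nonneg _
    · nlinarith

theorem norm_ip_self (z : F) : ‖ip C z z‖ = ‖z‖ ^ 2 := (CStarModule.norm_sq_eq Cᵐᵒᵖ).symm

theorem norm_ket (z : F) : ‖ket C z‖ = ‖z‖ := by
  refine le_antisymm (LinearMap.mkContinuous_norm_le _ (norm_nonneg _) _) ?_
  set b := ip C z z with hb
  have hbs : star b = b := star_ip z z
  have h1 : ‖b * b‖ = ‖b‖ * ‖b‖ := by
    nth_rewrite 1 [← hbs]
    exact CStarRing.norm_star_mul_self
  have h2 : ‖ket C z b‖ ^ 2 = ‖b‖ ^ 3 := by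
    rw [← norm_ip_self (C := C), ip_ket, ket_apply, ip_smul_right, ← hb, hbs]
    have h3 : ‖b * b * (b * b)‖ = ‖b * b‖ * ‖b * b‖ := by
      have : star (b * b) = b * b := by rw [star_mul, hbs]
      nth_rewrite 1 [← this]
      exact CStarRing.norm_star_mul_self
    refine le_antisymm ?_ ?_
    · calc ‖b * (b * b)‖ ≤ ‖b‖ * (‖b‖ * ‖b‖) :=
            (norm_mul_le _ _).trans (by gcongr; exact norm_mul_le _ _)
        _ = _ := by ring
    · rcases (norm_nonneg b).eq_or_lt with h0 | h0
      · rw [← h0]; simp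
      · have h4 : ‖b * b * (b * b)‖ ≤ ‖b‖ * ‖b * (b * b)‖ := by
          rw [mul_assoc]; exact norm_mul_le _ _
        rw [h3, h1] at h4
        refine le_of_mul_le_mul_left ?_ h0
        calc _ = ‖b‖ * ‖b‖ * (‖b‖ * ‖b‖) := by ring
          _ ≤ _ := h4
  have h5 : ‖ket C z b‖ ≤ ‖ket C z‖ * ‖b‖ := (ket C z).le_opNorm b
  have hb2 : ‖b‖ = ‖z‖ ^ 2 := norm_ip_self z
  rcases (norm_nonneg z).eq_or_lt with h0 | h0
  · rw [← h0]; exact norm_nonneg _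
  · have h6 : (‖z‖ ^ 3) ^ 2 ≤ (‖ket C z‖ * ‖z‖ ^ 2) ^ 2 := by
      calc (‖z‖ ^ 3) ^ 2 = ‖ket C z b‖ ^ 2 := by rw [h2, hb2]; ring
        _ ≤ _ := by rw [← hb2]; gcongr
    have h7 := abs_le_of_sq_le_sq' h6 (by positivity) |>.2
    refine le_of_mul_le_mul_right ?_ (pow_pos h0 2)
    calc _ = ‖z‖ ^ 3 := by ring
      _ ≤ _ := h7

theorem isClosed_range_bra [CompleteSpace F] : IsClosed (Set.range (bra C : F → F →L[ℂ] C)) := by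
  refine (Isometry.of_dist_eq fun x y => ?_).isClosedEmbedding.isClosed_range
  rw [dist_eq_norm, dist_eq_norm, ← norm_bra (C := C) (x - y)]
  congr 1
  ext v
  simp [← ipₛₗ_apply]

theorem isClosed_range_ket [CompleteSpace F] : IsClosed (Set.range (ket C : F → C →L[ℂ] F)) := by
  refine (Isometry.of_dist_eq fun x y => ?_).isClosedEmbedding.isClosed_range
  rw [dist_eq_norm, dist_eq_norm, ← norm_ket (C := C) (x - y)]
  congr 1
  ext v
  simp [← smulₗ_apply]

theorem isClosed_range_mul : IsClosed (Set.range (ContinuousLinearMap.mul ℂ C)) :=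
  (ContinuousLinearMap.isometry_mul ℂ C).isClosedEmbedding.isClosed_range

/-- The embedding of the first summand of `C ⊕ F`. -/
def inl : C →L[ℂ] Column C F :=
  (equivL (A := Cᵐᵒᵖ) (E := C × F) ℂ).symm.toContinuousLinearMap ∘L ContinuousLinearMap.inl ℂ C F

/-- The embedding of the second summand. -/
def inr : F →L[ℂ] Column C F :=
  (equivL (A := Cᵐᵒᵖ) (E := C × F) ℂ).symm.toContinuousLinearMap ∘L ContinuousLinearMap.inr ℂ C F

/-- The projection onto the first summand. -/
def prl : Column C F →L[ℂ] C :=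
  ContinuousLinearMap.fst ℂ C F ∘L (equivL (A := Cᵐᵒᵖ) (E := C × F) ℂ).toContinuousLinearMap

/-- The projection onto the second summand. -/
def prr : Column C F →L[ℂ] F :=
  ContinuousLinearMap.snd ℂ C F ∘L (equivL (A := Cᵐᵒᵖ) (E := C × F) ℂ).toContinuousLinearMap

theorem inl_prl_add_inr_prr (v : Column C F) : inl (prl v) + inr (prr v) = v :=
  column_ext (add_zero v.1) (zero_add v.2)

theorem mem_linkingSubalgebra_iff (X : Adjointable Cᵐᵒᵖ (Column C F)) :
    X ∈ linkingSubalgebra C F ↔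
      prl ∘L (X : Column C F →L[ℂ] Column C F) ∘L inl ∈ Set.range (ContinuousLinearMap.mul ℂ C) ∧
      prl ∘L (X : Column C F →L[ℂ] Column C F) ∘L inr ∈ Set.range (bra C : F → F →L[ℂ] C) ∧
      prr ∘L (X : Column C F →L[ℂ] Column C F) ∘L inl ∈ Set.range (ket C : F → C →L[ℂ] F) := by
  constructor
  · rintro ⟨c, y, z, a, rfl⟩
    refine ⟨⟨c, ?_⟩, ⟨y, ?_⟩, ⟨z, ?_⟩⟩
    · ext d
      change c * d = c * d + bra C y 0
      rw [map_zero, add_zero]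
    · ext d
      change ip C y d = c * 0 + ip C y d
      rw [mul_zero, zero_add]
    · ext d
      change op d • z = op d • z + (a : F →L[ℂ] F) 0
      rw [map_zero, add_zero]
  · rintro ⟨⟨c, hc⟩, ⟨y, hy⟩, ⟨z, hz⟩⟩
    have ha : IsAdjointPair Cᵐᵒᵖ (prr ∘L (X : Column C F →L[ℂ] Column C F) ∘L inr)
        (prr ∘L ((star X : Adjointable Cᵐᵒᵖ (Column C F)) : Column C F →L[ℂ] Column C F) ∘L
          inr) := by
      have hr : IsAdjointPair Cᵐᵒᵖ (inr : F →L[ℂ] Column C F) prr := by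
        rw [isAdjointPair_iff]
        intro x v
        change star (0 : C) * v.1 + ip C x v.2 = ip C x v.2
        rw [star_zero, zero_mul, zero_add]
      intro v w
      change inner _ (prr ((X : Column C F →L[ℂ] Column C F) (inr v))) w = _
      rw [hr.symm, Adjointable.isAdjointPair_star X, hr]
      rfl
    refine ⟨c, y, z, ⟨_, _, ha⟩, ?_⟩
    have key (v : Column C F) : (X : Column C F →L[ℂ] Column C F) v =
        (X : Column C F →L[ℂ] Column C F) (inl (prl v)) +
          (X : Column C F →L[ℂ] Column C F) (inr (prr v)) := by
      rw [← map_add, inl_prl_add_inr_prr]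
    refine block_ext (fun v => ?_) fun v => ?_
    · rw [key]
      exact congrArg₂ (· + ·) (DFunLike.congr_fun hc v.1).symm (DFunLike.congr_fun hy v.2).symm
    · rw [key]
      exact congrArg₂ (· + ·) (DFunLike.congr_fun hz v.1).symm rfl

instance [CompleteSpace F] :
    IsClosed (linkingSubalgebra C F : Set (Adjointable Cᵐᵒᵖ (Column C F))) := by
  have h : (linkingSubalgebra C F : Set (Adjointable Cᵐᵒᵖ (Column C F))) =
      (fun X : Adjointable Cᵐᵒᵖ (Column C F) =>
        prl ∘L (X : Column C F →L[ℂ] Column C F) ∘L inl) ⁻¹'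
          Set.range (ContinuousLinearMap.mul ℂ C) ∩
      ((fun X : Adjointable Cᵐᵒᵖ (Column C F) =>
        prl ∘L (X : Column C F →L[ℂ] Column C F) ∘L inr) ⁻¹' Set.range (bra C : F → F →L[ℂ] C) ∩
      (fun X : Adjointable Cᵐᵒᵖ (Column C F) =>
        prr ∘L (X : Column C F →L[ℂ] Column C F) ∘L inl) ⁻¹' Set.range (ket C : F → C →L[ℂ] F)) :=
    Set.ext mem_linkingSubalgebra_iff
  rw [h]
  refine (isClosed_range_mul.preimage ?_).inter
    ((isClosed_range_bra.preimage ?_).inter (isClosed_range_ket.preimage ?_))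
  all_goals
    exact continuous_const.clm_comp (continuous_subtype_val.clm_comp continuous_const)

variable (C F) in
/-- The extended linking algebra `[[C, F⋆], [F, 𝓑ᵃ(F)]]` of `F` as a C⋆-algebra. -/
def LinkingAlgebra : Type _ := linkingSubalgebra C F

namespace LinkingAlgebra

instance [CompleteSpace F] : NonUnitalCStarAlgebra (LinkingAlgebra C F) :=
  inferInstanceAs (NonUnitalCStarAlgebra (linkingSubalgebra C F))
instance [CompleteSpace F] : PartialOrder (LinkingAlgebra C F) := CStarAlgebra.spectralOrder _
instance [CompleteSpace F] : StarOrderedRing (LinkingAlgebra C F) :=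
  CStarAlgebra.spectralOrderedRing _

/-- An element of the extended linking algebra as an operator on `C ⊕ F`. -/
def toAdjointable (X : LinkingAlgebra C F) : Adjointable Cᵐᵒᵖ (Column C F) := Subtype.val X

/-- The element `[[c, y⋆], [z, a]]` of the extended linking algebra. -/
def of (c : C) (y z : F) (a : Adjointable Cᵐᵒᵖ F) : LinkingAlgebra C F :=
  ⟨block c y z a, c, y, z, a, rfl⟩

end LinkingAlgebra

end Linking

section Main

variable {B : Type*} [NonUnitalCStarAlgebra B] [PartialOrder B] [StarOrderedRing B]
variable {E : Type*} [NormedAddCommGroup E] [NormedSpace ℂ E] [SMul Bᵐᵒᵖ E] [CStarModule Bᵐᵒᵖ E]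
variable {C : Type*} [NonUnitalCStarAlgebra C] [PartialOrder C] [StarOrderedRing C]
variable {F : Type*} [NormedAddCommGroup F] [NormedSpace ℂ F] [SMul Cᵐᵒᵖ F] [CStarModule Cᵐᵒᵖ F]

/-- A map between extended linking algebras is strict if it sends bounded strictly convergent nets
to strictly convergent nets. Nets are expressed through filters on the domain. -/
def IsStrict [CompleteSpace E] (Φ : LinkingAlgebra B E → LinkingAlgebra C F) : Prop :=
  ∀ (l : Filter (LinkingAlgebra B E)) (X : LinkingAlgebra B E),
    (∃ M : ℝ, ∀ᶠ Y in l, ‖Y‖ ≤ M) →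
    TendstoStrictly B (fun Y => Y.toAdjointable) l X.toAdjointable →
    TendstoStrictly C (fun Y => (Φ Y).toAdjointable) l (Φ X).toAdjointable

end Main

/-- A `B`-`C`-correspondence: a Hilbert `C`-module with a nondegenerate left action of `B` by
adjointable operators. -/
structure Correspondence (B : Type u) (C : Type v) [NonUnitalCStarAlgebra B]
    [NonUnitalCStarAlgebra C] [PartialOrder C] [StarOrderedRing C] where
  /-- The underlying space. -/
  carrier : Type w
  [normedAddCommGroup : NormedAddCommGroup carrier]
  [normedSpace : NormedSpace ℂ carrier]
  [smul : SMul Cᵐᵒᵖ carrier]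
  [cstarModule : CStarModule Cᵐᵒᵖ carrier]
  [completeSpace : CompleteSpace carrier]
  /-- The left action of `B`. -/
  action : B →⋆ₙₐ[ℂ] Adjointable Cᵐᵒᵖ carrier
  nondegenerate : (Submodule.span ℂ
    {y | ∃ b x, y = (action b : carrier →L[ℂ] carrier) x}).topologicalClosure = ⊤

attribute [instance] Correspondence.normedAddCommGroup Correspondence.normedSpace
  Correspondence.smul Correspondence.cstarModule Correspondence.completeSpace

end HilbertModule

end

open HilbertModule
open scoped CStarAlgebra

noncomputable section

namespace HilbertModule

open MulOpposite Filter Topology WithCStarModule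
open scoped TensorProduct CStarAlgebra

set_option linter.unusedSectionVars false

/-! ### Extending operators, adjoints and representations from total or dense subsets -/

section Total

/-! Given a factorization `T x = ξ₂⋆ (x ⊙ ξ₁)` through `𝔉`, the extension can be written down. Let
`W : C ⊕ F → (B ⊕ E) ⊙ 𝔉` send `(c, y)` to `((1, 0) ⊙ ξ₁) c + (inr ⊙ id) ξ₂ y`. This operator is
adjointable, and `X ↦ W⋆ (X ⊙ id) W` acts block by block, with corners `b ↦ ⟨ξ₁, b ξ₁⟩`, `T`, `T⋆`
and `a ↦ ξ₂⋆ (a ⊙ id) ξ₂`. Compressions of ⋆-homomorphisms are completely positive. Strictness holds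
because `B` is unital: every vector of `B ⊕ E` is then the value of a rank-one operator, so strict
convergence gives pointwise convergence, which passes to elementary tensors and, by boundedness, to
the whole tensor product. See `exists_cp_extension`.

Conversely, a completely positive extension `Ψ` is dilated by a GNS construction that is cut by an
element `P` of the linking algebra: `X ⊗ v` and `Y ⊗ w` have inner product `⟨v, Ψ((P X)⋆ (P Y)) w⟩`.
For `P = [[1, 0], [0, 0]]` only the first row of `X` counts; the result is a Hilbert `C`-module with
a nondegenerate left action of `B`, and this is `𝔉`. For `P` the identity the full GNS module
arises. Since `x⋆ y = ⟨x, y⟩` inside the linking algebra, `x ⊙ (X ⊗ v) ↦ x X ⊗ v` embeds `E ⊙ 𝔉`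
isometrically into the full module (`exists_tensor_isometry`).

The range of this embedding contains all `z y⋆ ⊗ v`, hence all `k ⊗ v` with `k` a compact operator
on `E`. Strictness enters exactly here: along an approximate unit of the compacts, `Ψ((1 - k)⋆ (1 -
k))` tends strictly to zero, so that `1_E ⊗ v` lies in the range as well, where `1_E` is the unit of
the lower right corner (`gvec_corner_one_mem`). Pulling `v ↦ 1_E ⊗ v` back to `E ⊙ 𝔉` gives an
operator whose adjoint sends `x ⊙ (X ⊗ v)` to `Ψ(x X) v` (`exists_gns_lift`); restricting it to `F`
gives `ξ₂`. The natural choice `ξ₁ = 1_B ⊗ (1, 0)` is not available because `C` need not have a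
unit; it is replaced by the limit of `1_B ⊗ (e, 0)` along an approximate unit `e` of `C`. -/

theorem mem_of_total {G : Type*} [NormedAddCommGroup G] [NormedSpace ℂ G] {s : Set G}
    (hs : (Submodule.span ℂ s).topologicalClosure = ⊤) {W : Submodule ℂ G}
    (hW : IsClosed (W : Set G)) (h : s ⊆ W) (t : G) : t ∈ W :=
  Submodule.topologicalClosure_minimal _ (Submodule.span_le.2 h) hW (hs ▸ Submodule.mem_top)

theorem eq_of_total {G G' : Type*} [NormedAddCommGroup G] [NormedSpace ℂ G]
    [NormedAddCommGroup G'] [NormedSpace ℂ G'] {s : Set G}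
    (hs : (Submodule.span ℂ s).topologicalClosure = ⊤) {f g : G →L[ℂ] G'}
    (h : ∀ t ∈ s, f t = g t) : f = g :=
  ContinuousLinearMap.ext fun t =>
    mem_of_total hs (W := LinearMap.eqLocus (f : G →ₗ[ℂ] G') (g : G →ₗ[ℂ] G'))
      (isClosed_eq f.continuous g.continuous) h t

/-- A bounded family of operators which converges on a set converges on its closed span. -/
theorem tendsto_apply_of_mem_closure {G G' ι : Type*} [NormedAddCommGroup G] [NormedSpace ℂ G]
    [NormedAddCommGroup G'] [NormedSpace ℂ G'] {s : Set G}
    {f : ι → G →L[ℂ] G'} {g : G →L[ℂ] G'} {l : Filter ι} {M : ℝ} (hM : ∀ᶠ i in l, ‖f i‖ ≤ M)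
    (h : ∀ t ∈ s, Tendsto (fun i => f i t) l (𝓝 (g t))) {t : G}
    (ht : t ∈ (Submodule.span ℂ s).topologicalClosure) :
    Tendsto (fun i => f i t) l (𝓝 (g t)) := by
  let W : Submodule ℂ G :=
    { carrier := {t | Tendsto (fun i => f i t) l (𝓝 (g t))}
      add_mem' := fun {a b} ha hb => by simpa using Tendsto.add ha hb
      zero_mem' := by simpa using tendsto_const_nhds
      smul_mem' := fun c a ha => by simpa using Tendsto.const_smul ha c }
  refine Submodule.topologicalClosure_minimal (t := W) _ (Submodule.span_le.2 h)
    (isClosed_of_closure_subset fun t ht => ?_) ht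
  change Tendsto (fun i => f i t) l (𝓝 (g t))
  rw [Metric.tendsto_nhds]
  intro ε hε
  set K := |M| + ‖g‖ + 1 with hK
  have hK0 : 0 < K := by positivity
  obtain ⟨t', ht', hd⟩ := Metric.mem_closure_iff.1 ht (ε / (2 * K)) (by positivity)
  filter_upwards [hM, Metric.tendsto_nhds.1 (show Tendsto _ _ _ from ht') (ε / 2) (by positivity)]
    with i h1 h2
  rw [dist_eq_norm] at hd h2 ⊢
  have h3 : ‖f i (t - t')‖ ≤ |M| * ‖t - t'‖ :=
    ((f i).le_opNorm _).trans (by gcongr; exact h1.trans (le_abs_self M))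
  have h4 : ‖g (t - t')‖ ≤ ‖g‖ * ‖t - t'‖ := g.le_opNorm _
  have h5 : f i t - g t = f i (t - t') + (f i t' - g t') - g (t - t') := by
    rw [map_sub, map_sub]; abel
  have h6 : K * ‖t - t'‖ < ε / 2 := by
    calc K * ‖t - t'‖ < K * (ε / (2 * K)) := by gcongr
      _ = _ := by field_simp
  calc ‖f i t - g t‖ ≤ ‖f i (t - t')‖ + ‖f i t' - g t'‖ + ‖g (t - t')‖ := by
        rw [h5]; exact (norm_sub_le _ _).trans (by gcongr; exact norm_add_le _ _)
    _ < ε := by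
        have : 0 ≤ ‖t - t'‖ := norm_nonneg _
        rw [hK] at h6
        nlinarith

/-- Finitely supported functions serve as coordinates: an operator prescribed on a total family is
defined on them first and then extended by density. -/
theorem denseRange_linearCombination {G S : Type*} [NormedAddCommGroup G] [NormedSpace ℂ G]
    {g : S → G} (hg : (Submodule.span ℂ (Set.range g)).topologicalClosure = ⊤) :
    DenseRange (Finsupp.linearCombination ℂ g) := by
  rw [DenseRange, ← LinearMap.coe_range, Finsupp.range_linearCombination]
  exact (Submodule.dense_iff_topologicalClosure_eq_top).2 hg

variable {A : Type*} [NonUnitalCStarAlgebra A] [PartialOrder A] [StarOrderedRing A]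
variable {F : Type*} [NormedAddCommGroup F] [NormedSpace ℂ F] [SMul A F] [CStarModule A F]
variable {G : Type*} [NormedAddCommGroup G] [NormedSpace ℂ G] [SMul A G] [CStarModule A G]
variable {G' : Type*} [NormedAddCommGroup G'] [NormedSpace ℂ G'] [SMul A G'] [CStarModule A G']

theorem norm_le_of_inner_le {x : F} {y : G} {r : ℝ} (hr : 0 ≤ r)
    (h : ‖inner A x x‖ ≤ r ^ 2 * ‖inner A y y‖) : ‖x‖ ≤ r * ‖y‖ := by
  refine abs_le_of_sq_le_sq' ?_ (by positivity) |>.2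
  rwa [mul_pow, CStarModule.norm_sq_eq A, CStarModule.norm_sq_eq A]

theorem norm_eq_of_inner_eq {x : F} {y : G} (h : inner A x x = inner A y y) : ‖x‖ = ‖y‖ := by
  rw [CStarModule.norm_eq_sqrt_norm_inner_self (A := A), h,
    ← CStarModule.norm_eq_sqrt_norm_inner_self (A := A)]

/-- The inner product is conjugate linear in its first slot, so both sides are compared after taking
adjoints, where they become continuous linear in `t`. -/
theorem inner_eq_of_total {s : Set F} (hs : (Submodule.span ℂ s).topologicalClosure = ⊤)
    (J : F →L[ℂ] G) {w : G} {w' : F} (h : ∀ t ∈ s, inner A (J t) w = inner A t w') (t : F) :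
    inner A (J t) w = inner A t w' := by
  have key : CStarModule.innerSL (A := A) w ∘L J = CStarModule.innerSL (A := A) w' := by
    refine eq_of_total hs fun t ht => ?_
    have := congrArg star (h t ht)
    rwa [CStarModule.star_inner, CStarModule.star_inner] at this
  rw [← CStarModule.star_inner, ← CStarModule.star_inner w']
  exact congrArg star (DFunLike.congr_fun key t)

/-- A bounded operator is adjointable if its adjoint is defined on a total set. -/
theorem exists_adjoint_of_total [CompleteSpace F] {s : Set G}
    (hs : (Submodule.span ℂ s).topologicalClosure = ⊤) (ξ : F →L[ℂ] G)
    (h : ∀ t ∈ s, ∃ r, ∀ y, inner A (ξ y) t = inner A y r) : ∃ ξ', IsAdjointPair A ξ ξ' := by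
  -- Testing with `y = r` gives `‖r‖² = ‖⟨ξ r, t⟩‖`. The same bound makes the domain of the adjoint
  -- closed and the adjoint itself bounded.
  have bound {t : G} {r : F} (h : ∀ y, inner A (ξ y) t = inner A y r) : ‖r‖ ≤ ‖ξ‖ * ‖t‖ := by
    rcases (norm_nonneg r).eq_or_lt with h0 | h0
    · rw [← h0]; positivity
    refine le_of_mul_le_mul_left ?_ h0
    calc ‖r‖ * ‖r‖ = ‖inner A (ξ r) t‖ := by rw [h, ← CStarModule.norm_sq_eq A, sq]
      _ ≤ ‖ξ r‖ * ‖t‖ := CStarModule.norm_inner_le G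
      _ ≤ (‖ξ‖ * ‖r‖) * ‖t‖ := by gcongr; exact ξ.le_opNorm r
      _ = _ := by ring
  let W : Submodule ℂ G :=
    { carrier := {t | ∃ r, ∀ y, inner A (ξ y) t = inner A y r}
      add_mem' := by
        rintro a b ⟨r, hr⟩ ⟨r', hr'⟩
        exact ⟨r + r', fun y => by simp [hr, hr']⟩
      zero_mem' := ⟨0, fun y => by simp⟩
      smul_mem' := by
        rintro c a ⟨r, hr⟩
        exact ⟨c • r, fun y => by simp [hr]⟩ }
  have hW : IsClosed (W : Set G) := by
    refine isClosed_of_closure_subset fun t ht => ?_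
    obtain ⟨u, hu, hlim⟩ := mem_closure_iff_seq_limit.1 ht
    choose r hr using hu
    have hc : CauchySeq r := by
      have := hlim.cauchySeq
      rw [Metric.cauchySeq_iff] at this ⊢
      intro ε hε
      obtain ⟨N, hN⟩ := this (ε / (‖ξ‖ + 1)) (by positivity)
      refine ⟨N, fun m hm n hn => ?_⟩
      have h1 := hN m hm n hn
      rw [dist_eq_norm] at h1 ⊢
      rw [lt_div_iff₀ (by positivity)] at h1
      have h2 : ‖r m - r n‖ ≤ ‖ξ‖ * ‖u m - u n‖ := bound fun y => by simp [hr]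
      nlinarith [norm_nonneg (u m - u n)]
    obtain ⟨b, hb⟩ := cauchySeq_tendsto_of_complete hc
    refine ⟨b, fun y => tendsto_nhds_unique (f := fun n => inner A (ξ y) (u n)) (l := atTop)
      ((CStarModule.continuous_inner (A := A) (E := G)).tendsto (ξ y, t) |>.comp
        (tendsto_const_nhds.prodMk_nhds hlim)) ?_⟩
    simp only [hr]
    exact (CStarModule.continuous_inner (A := A) (E := F)).tendsto (y, b) |>.comp
        (tendsto_const_nhds.prodMk_nhds hb)
  choose f hf using fun t => (mem_of_total hs hW h t : ∃ r, ∀ y, inner A (ξ y) t = inner A y r)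
  refine ⟨LinearMap.mkContinuous
    { toFun := f
      map_add' := fun a b => ext_inner A fun y => by simp [← hf]
      map_smul' := fun c a => ext_inner A fun y => by simp [← hf] } ‖ξ‖
    fun t => bound (hf t), fun y t => hf t y⟩

/-- Two families with the same Gram matrix are intertwined by an isometry. -/
theorem exists_isometry_of_gram_eq [CompleteSpace G'] {S : Type*} {g : S → G} {g' : S → G'}
    (hg : (Submodule.span ℂ (Set.range g)).topologicalClosure = ⊤)
    (h : ∀ s t, inner A (g s) (g t) = inner A (g' s) (g' t)) :
    ∃ J : G →L[ℂ] G', (∀ s, J (g s) = g' s) ∧ (∀ x y, inner A (J x) (J y) = inner A x y) := by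
  have hd := denseRange_linearCombination hg
  have hin (a b : S →₀ ℂ) : inner A (Finsupp.linearCombination ℂ g' a)
      (Finsupp.linearCombination ℂ g' b) = inner A (Finsupp.linearCombination ℂ g a)
      (Finsupp.linearCombination ℂ g b) := by
    simp [Finsupp.linearCombination_apply, Finsupp.sum, CStarModule.inner_sum_left,
      CStarModule.inner_sum_right, h]
  have hn : ∃ K : ℝ, ∀ a, ‖Finsupp.linearCombination ℂ g' a‖ ≤
      K * ‖Finsupp.linearCombination ℂ g a‖ :=
    ⟨1, fun a => by rw [one_mul]; exact (norm_eq_of_inner_eq (hin a a)).le⟩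
  -- Equality of the Gram matrices gives equal norms for equal coefficients, so the extension is
  -- well defined, with constant `1`.
  set J := (Finsupp.linearCombination ℂ g').extendOfNorm (Finsupp.linearCombination ℂ g) with hJ
  have hJa (a : S →₀ ℂ) : J (Finsupp.linearCombination ℂ g a) =
      Finsupp.linearCombination ℂ g' a := LinearMap.extendOfNorm_eq hd hn a
  refine ⟨J, fun s => by simpa using hJa (Finsupp.single s 1), fun x y => ?_⟩
  refine hd.induction_on₂ (p := fun x y => inner A (J x) (J y) = inner A x y)
    (isClosed_eq ?_ ?_) (fun a b => ?_) x y
  · exact (CStarModule.continuous_inner (A := A) (E := G')).comp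
      ((J.continuous.comp continuous_fst).prodMk (J.continuous.comp continuous_snd))
  · exact CStarModule.continuous_inner (A := A) (E := G)
  · rw [hJa, hJa, hin]

/-- A representation by formally adjointable maps of a unital C⋆-algebra on a dense subspace extends
to the Hilbert module. -/
theorem exists_starHom_of_dense [CompleteSpace G] {D V : Type*} [CStarAlgebra D] [AddCommGroup V]
    [Module ℂ V] {ι : V →ₗ[ℂ] G} (hι : DenseRange ι) (ρ : D → V →ₗ[ℂ] V)
    (hadd : ∀ d e t, ι (ρ (d + e) t) = ι (ρ d t) + ι (ρ e t))
    (hsmul : ∀ (c : ℂ) d t, ι (ρ (c • d) t) = c • ι (ρ d t))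
    (hone : ∀ t, ι (ρ 1 t) = ι t) (hmul : ∀ d e t, ι (ρ (d * e) t) = ι (ρ d (ρ e t)))
    (hstar : ∀ d s t, inner A (ι (ρ d s)) (ι t) = inner A (ι s) (ι (ρ (star d) t))) :
    ∃ π : D →⋆ₙₐ[ℂ] Adjointable A G, ∀ d t, (π d : G →L[ℂ] G) (ι t) = ι (ρ d t) := by
  let _ := CStarAlgebra.spectralOrder D
  have _ := CStarAlgebra.spectralOrderedRing D
  -- Boundedness is automatic: `‖d‖² - d⋆ d` is positive, hence of the form `c⋆ c`, and therefore
  -- `‖d‖² ⟨t, t⟩ = ⟨d t, d t⟩ + ⟨c t, c t⟩`. The unit of `D` is used for this.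
  have bound (d : D) (t : V) : ‖ι (ρ d t)‖ ≤ ‖d‖ * ‖ι t‖ := by
    obtain ⟨c, hc⟩ := CStarAlgebra.nonneg_iff_eq_star_mul_self.1
      (sub_nonneg.2 (CStarAlgebra.star_mul_le_algebraMap_norm_sq (a := d)))
    have hd : ((‖d‖ ^ 2 : ℝ) : ℂ) • (1 : D) = star d * d + star c * c := by
      rw [← hc, Algebra.algebraMap_eq_smul_one, Complex.coe_smul]; abel
    have h1 : ((‖d‖ ^ 2 : ℝ) : ℂ) • inner A (ι t) (ι t) =
        inner A (ι (ρ d t)) (ι (ρ d t)) + inner A (ι (ρ c t)) (ι (ρ c t)) := by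
      rw [hstar, hstar, ← hmul, ← hmul, ← CStarModule.inner_add_right, ← hadd, ← hd, hsmul, hone,
        CStarModule.inner_smul_right_complex]
    refine norm_le_of_inner_le (A := A) (norm_nonneg d) ?_
    calc _ ≤ ‖((‖d‖ ^ 2 : ℝ) : ℂ) • inner A (ι t) (ι t)‖ :=
          CStarAlgebra.norm_le_norm_of_nonneg_of_le CStarModule.inner_self_nonneg
            (by rw [h1]; exact le_add_of_nonneg_right CStarModule.inner_self_nonneg)
      _ = _ := by rw [norm_smul, Complex.norm_real, Real.norm_of_nonneg (by positivity)]
  let T (d : D) : G →L[ℂ] G := (ι ∘ₗ ρ d).extendOfNorm ι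
  have hT (d : D) (t : V) : T d (ι t) = ι (ρ d t) :=
    LinearMap.extendOfNorm_eq hι ⟨‖d‖, bound d⟩ t
  have hadj (d : D) : IsAdjointPair A (T d) (T (star d)) := fun x y =>
    hι.induction_on₂ (p := fun x y => inner A (T d x) y = inner A x (T (star d) y))
      (isClosed_eq
        ((CStarModule.continuous_inner (A := A) (E := G)).comp
          (((T d).continuous.comp continuous_fst).prodMk continuous_snd))
        ((CStarModule.continuous_inner (A := A) (E := G)).comp
          (continuous_fst.prodMk ((T (star d)).continuous.comp continuous_snd))))
      (fun s t => by rw [hT, hT, hstar]) x y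
  have hext {f g : G →L[ℂ] G} (h : ∀ t, f (ι t) = g (ι t)) : f = g :=
    ContinuousLinearMap.ext fun x => congrFun (hι.equalizer f.continuous g.continuous
      (funext h)) x
  refine ⟨
    { toFun := fun d => ⟨T d, T (star d), hadj d⟩
      map_smul' := fun c d => Subtype.ext (hext fun t => by simp [hT, hsmul])
      map_zero' := Subtype.ext (hext fun t => by
        have := hsmul 0 0 t
        simp only [zero_smul] at this
        simp [hT, this])
      map_add' := fun d e => Subtype.ext (hext fun t => by simp [hT, hadd])
      map_mul' := fun d e => Subtype.ext (hext fun t => by simp [hT, hmul])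
      map_star' := fun d => (Adjointable.star_eq_of_isAdjointPair (hadj d)).symm }, hT⟩

end Total

/-! ### Compact operators and strict convergence -/

section Strict

variable {C : Type*} [NonUnitalCStarAlgebra C] [PartialOrder C] [StarOrderedRing C]
variable {F : Type*} [NormedAddCommGroup F] [NormedSpace ℂ F] [SMul Cᵐᵒᵖ F] [CStarModule Cᵐᵒᵖ F]

theorem norm_star_adjointable (a : Adjointable Cᵐᵒᵖ F) : ‖star a‖ = ‖a‖ :=
  (Adjointable.isAdjointPair_star a).norm_eq.symm

theorem rankOne_apply (z y x : F) : (rankOne C z y : F →L[ℂ] F) x = op (ip C y x) • z := rfl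

theorem rankOne_mem_compacts (z y : F) : rankOne C z y ∈ compacts C F :=
  Submodule.le_topologicalClosure _ (Submodule.subset_span ⟨z, y, rfl⟩)

theorem mul_rankOne (a : Adjointable Cᵐᵒᵖ F) (z y : F) :
    a * rankOne C z y = rankOne C ((a : F →L[ℂ] F) z) y :=
  Subtype.ext (ContinuousLinearMap.ext fun x => map_op_smul a (ip C y x) z)

theorem star_rankOne (z y : F) : star (rankOne C z y) = rankOne C y z :=
  Adjointable.star_eq_of_isAdjointPair (isAdjointPair_iff.2 fun u v => by
    rw [rankOne_apply, rankOne_apply, ip_smul_left, ip_smul_right, star_ip])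

theorem rankOne_mul (a : Adjointable Cᵐᵒᵖ F) (z y : F) :
    rankOne C z y * a = rankOne C z (((star a : Adjointable Cᵐᵒᵖ F) : F →L[ℂ] F) y) := by
  rw [← star_star (rankOne C z y * a), star_mul, star_rankOne, mul_rankOne, star_rankOne]

theorem norm_rankOne_le (z y : F) : ‖rankOne C z y‖ ≤ ‖z‖ * ‖y‖ := by
  have := (ket C z).opNorm_comp_le (bra C y)
  rwa [norm_ket, norm_bra] at this

theorem rankOne_sub_left (z z' y : F) : rankOne C (z - z') y = rankOne C z y - rankOne C z' y :=
  Subtype.ext (ContinuousLinearMap.ext fun x => map_sub (smulₗ (op (ip C y x))) z z')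

theorem tendsto_rankOne {ι : Type*} {l : Filter ι} {u : ι → F} {z : F} (h : Tendsto u l (𝓝 z))
    (y : F) : Tendsto (fun i => rankOne C (u i) y) l (𝓝 (rankOne C z y)) := by
  rw [tendsto_iff_norm_sub_tendsto_zero] at h ⊢
  refine squeeze_zero (fun _ => norm_nonneg _) (fun i => ?_) (by simpa using h.mul_const ‖y‖)
  rw [← rankOne_sub_left]
  exact norm_rankOne_le _ _

variable [CompleteSpace F]

theorem star_mem_compacts {k : Adjointable Cᵐᵒᵖ F} (hk : k ∈ compacts C F) :
    star k ∈ compacts C F := by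
  have h : Set.MapsTo star (Submodule.span ℂ {a | ∃ z y, a = rankOne C (F := F) z y} :
      Set (Adjointable Cᵐᵒᵖ F))
      (Submodule.span ℂ {a | ∃ z y, a = rankOne C (F := F) z y}) := by
    intro a ha
    induction ha using Submodule.span_induction with
    | mem a ha =>
      obtain ⟨z, y, rfl⟩ := ha
      exact Submodule.subset_span ⟨y, z, star_rankOne z y⟩
    | zero => simp
    | add a b _ _ ha hb => rw [star_add]; exact Submodule.add_mem _ ha hb
    | smul c a _ ha => rw [star_smul]; exact Submodule.smul_mem _ _ ha
  exact h.closure continuous_star hk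

theorem mul_mem_compacts (a : Adjointable Cᵐᵒᵖ F) {k : Adjointable Cᵐᵒᵖ F}
    (hk : k ∈ compacts C F) : a * k ∈ compacts C F := by
  have h : Set.MapsTo (a * ·) (Submodule.span ℂ {a | ∃ z y, a = rankOne C (F := F) z y} :
      Set (Adjointable Cᵐᵒᵖ F))
      (Submodule.span ℂ {a | ∃ z y, a = rankOne C (F := F) z y}) := by
    intro b hb
    induction hb using Submodule.span_induction with
    | mem b hb =>
      obtain ⟨z, y, rfl⟩ := hb
      exact Submodule.subset_span ⟨_, y, mul_rankOne a z y⟩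
    | zero => simp
    | add b c _ _ hb hc => simpa only [mul_add, SetLike.mem_coe] using Submodule.add_mem _ hb hc
    | smul c b _ hb =>
      simpa only [mul_smul_comm, SetLike.mem_coe] using Submodule.smul_mem _ _ hb
  exact h.closure (continuous_const_mul a) hk

variable (C F) in
/-- The compact operators as a star subalgebra of `𝓑ᵃ(F)`. -/
def compactsSubalgebra : NonUnitalStarSubalgebra ℂ (Adjointable Cᵐᵒᵖ F) where
  carrier := compacts C F
  add_mem' := (compacts C F).add_mem
  zero_mem' := (compacts C F).zero_mem
  smul_mem' c _ := (compacts C F).smul_mem c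
  mul_mem' {a _} _ hb := mul_mem_compacts a hb
  star_mem' := star_mem_compacts

instance : IsClosed (compactsSubalgebra C F : Set (Adjointable Cᵐᵒᵖ F)) :=
  Submodule.isClosed_topologicalClosure _

/-- The compact operators have an approximate unit, which converges strongly to the identity. -/
theorem exists_approximateUnit_compacts :
    ∃ l : Filter (Adjointable Cᵐᵒᵖ F), l.NeBot ∧
      (∀ᶠ k in l, k ∈ compacts C F ∧ star k = k ∧ ‖k‖ ≤ 1) ∧
      ∀ x : F, Tendsto (fun k : Adjointable Cᵐᵒᵖ F => (k : F →L[ℂ] F) x) l (𝓝 x) := by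
  let _ : PartialOrder (compactsSubalgebra C F) := CStarAlgebra.spectralOrder _
  have _ := CStarAlgebra.spectralOrderedRing (compactsSubalgebra C F)
  have h := CStarAlgebra.increasingApproximateUnit (compactsSubalgebra C F)
  have h0 := h.neBot
  set l := CStarAlgebra.approximateUnit (compactsSubalgebra C F)
  have hev : ∀ᶠ k : compactsSubalgebra C F in l, (k : Adjointable Cᵐᵒᵖ F) ∈ compacts C F ∧
      star (k : Adjointable Cᵐᵒᵖ F) = k ∧ ‖(k : Adjointable Cᵐᵒᵖ F)‖ ≤ 1 := by
    filter_upwards [h.eventually_star_eq, h.eventually_norm] with k h1 h2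
    exact ⟨k.2, congrArg Subtype.val h1, h2⟩
  refine ⟨l.map Subtype.val, h0.map _, hev, fun x => ?_⟩
  rw [tendsto_map'_iff, tendsto_iff_norm_sub_tendsto_zero]
  -- The algebraic property of the approximate unit, applied to `x x⋆`, controls the single vector
  -- `x`.
  let r : compactsSubalgebra C F := ⟨rankOne C x x, rankOne_mem_compacts x x⟩
  have h1 : Tendsto (fun k : compactsSubalgebra C F =>
      ‖(k : Adjointable Cᵐᵒᵖ F) * rankOne C x x - rankOne C x x‖) l (𝓝 0) :=
    tendsto_iff_norm_sub_tendsto_zero.1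
      ((continuous_subtype_val.tendsto r).comp (h.tendsto_mul_right r))
  have h2 : Tendsto (fun k : compactsSubalgebra C F =>
      √(‖(k : Adjointable Cᵐᵒᵖ F) * rankOne C x x - rankOne C x x‖ * 2)) l (𝓝 0) := by
    simpa using (h1.mul_const 2).sqrt
  refine squeeze_zero' (Eventually.of_forall fun _ => norm_nonneg _) ?_ h2
  filter_upwards [hev] with k hk
  refine Real.le_sqrt_of_sq_le ?_
  set y := ((k : Adjointable Cᵐᵒᵖ F) : F →L[ℂ] F) x - x with hy
  -- For `y = k x - x` one has `y y⋆ = (k - 1) x x⋆ (k - 1)⋆`. Together with `‖y‖² ≤ ‖y y⋆‖` and `‖k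
  -- - 1‖ ≤ 2` this explains the factor `2` under the root above.
  have h3 : rankOne C y y = ((k : Adjointable Cᵐᵒᵖ F) * rankOne C x x - rankOne C x x) *
      ((k : Adjointable Cᵐᵒᵖ F) - 1) := by
    have : ((k : Adjointable Cᵐᵒᵖ F) * rankOne C x x - rankOne C x x) =
        ((k : Adjointable Cᵐᵒᵖ F) - 1) * rankOne C x x := by rw [sub_mul, one_mul]
    rw [this, mul_rankOne, rankOne_mul, star_sub, hk.2.1, star_one]
    rfl
  have h4 : ‖y‖ ^ 2 ≤ ‖rankOne C y y‖ := by
    have : IsAdjointPair Cᵐᵒᵖ (bra C y) (ket C y) := fun u v => by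
      apply unop_injective
      change star (ip C y u) * v = ip C u (op v • y)
      rw [star_ip, ip_smul_right]
    have := this.norm_sq_le
    rwa [norm_bra] at this
  calc ‖y‖ ^ 2 ≤ ‖rankOne C y y‖ := h4
    _ ≤ ‖(k : Adjointable Cᵐᵒᵖ F) * rankOne C x x - rankOne C x x‖ *
        ‖(k : Adjointable Cᵐᵒᵖ F) - 1‖ := by rw [h3]; exact norm_mul_le _ _
    _ ≤ _ := by
      have h5 : ‖(1 : Adjointable Cᵐᵒᵖ F)‖ ≤ 1 := ContinuousLinearMap.norm_id_le
      have h6 : ‖(k : Adjointable Cᵐᵒᵖ F) - 1‖ ≤ 2 :=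
        (norm_sub_le _ _).trans (by linarith [hk.2.2])
      exact mul_le_mul_of_nonneg_left h6 (norm_nonneg _)

/-- Since `a (z y⋆) = (a z) y⋆`, pointwise convergence gives norm convergence of the products with
rank-one operators. Boundedness carries this to their closed span, and multiplication from the other
side follows by passing to adjoints, which is why pointwise convergence of the adjoints is also
needed. -/
theorem tendstoStrictly_of_pointwise {ι : Type*} {l : Filter ι} {u : ι → Adjointable Cᵐᵒᵖ F}
    {a : Adjointable Cᵐᵒᵖ F} {M : ℝ} (hM : ∀ᶠ i in l, ‖u i‖ ≤ M)
    (h : ∀ z, Tendsto (fun i => (u i : F →L[ℂ] F) z) l (𝓝 ((a : F →L[ℂ] F) z)))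
    (h' : ∀ z, Tendsto (fun i => ((star (u i) : Adjointable Cᵐᵒᵖ F) : F →L[ℂ] F) z) l
      (𝓝 (((star a : Adjointable Cᵐᵒᵖ F) : F →L[ℂ] F) z))) :
    TendstoStrictly C u l a := by
  have key {v : ι → Adjointable Cᵐᵒᵖ F} {b : Adjointable Cᵐᵒᵖ F} (hM : ∀ᶠ i in l, ‖v i‖ ≤ M)
      (h : ∀ z, Tendsto (fun i => (v i : F →L[ℂ] F) z) l (𝓝 ((b : F →L[ℂ] F) z)))
      {k : Adjointable Cᵐᵒᵖ F} (hk : k ∈ compacts C F) :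
      Tendsto (fun i => v i * k) l (𝓝 (b * k)) := by
    refine tendsto_apply_of_mem_closure (f := fun i => ContinuousLinearMap.mul ℂ _ (v i))
      (g := ContinuousLinearMap.mul ℂ _ b) (M := M) ?_ ?_ hk
    · filter_upwards [hM] with i hi
      exact (ContinuousLinearMap.opNorm_mul_apply_le ℂ _ (v i)).trans hi
    · rintro _ ⟨z, y, rfl⟩
      simp only [ContinuousLinearMap.mul_apply', mul_rankOne]
      exact tendsto_rankOne (h z) y
  refine fun k hk => ⟨key hM h hk, ?_⟩
  have := (key (v := fun i => star (u i)) (by simpa only [norm_star_adjointable] using hM) h'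
    (star_mem_compacts hk)).star
  simpa using this

theorem TendstoStrictly.apply {ι : Type*} {l : Filter ι} {u : ι → Adjointable Cᵐᵒᵖ F}
    {a : Adjointable Cᵐᵒᵖ F} (h : TendstoStrictly C u l a) {k : Adjointable Cᵐᵒᵖ F}
    (hk : k ∈ compacts C F) (z : F) :
    Tendsto (fun i => (u i : F →L[ℂ] F) ((k : F →L[ℂ] F) z)) l
      (𝓝 ((a : F →L[ℂ] F) ((k : F →L[ℂ] F) z))) :=
  ((ContinuousLinearMap.apply ℂ F z).continuous.comp continuous_subtype_val).tendsto (a * k)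
    |>.comp (h k hk).1

theorem TendstoStrictly.star {ι : Type*} {l : Filter ι} {u : ι → Adjointable Cᵐᵒᵖ F}
    {a : Adjointable Cᵐᵒᵖ F} (h : TendstoStrictly C u l a) :
    TendstoStrictly C (fun i => star (u i)) l (star a) := fun k hk => by
  have := h _ (star_mem_compacts hk)
  exact ⟨by simpa using this.2.star, by simpa using this.1.star⟩

/-- Over a unital algebra strict convergence on `B ⊕ E` implies pointwise convergence. -/
theorem TendstoStrictly.apply_column {B : Type*} [CStarAlgebra B] [PartialOrder B]
    [StarOrderedRing B] {E : Type*} [NormedAddCommGroup E] [NormedSpace ℂ E] [SMul Bᵐᵒᵖ E]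
    [CStarModule Bᵐᵒᵖ E] [CompleteSpace E] {ι : Type*} {l : Filter ι}
    {u : ι → Adjointable Bᵐᵒᵖ (Column B E)}
    {a : Adjointable Bᵐᵒᵖ (Column B E)} (h : TendstoStrictly B u l a) (z : Column B E) :
    Tendsto (fun i => (u i : Column B E →L[ℂ] Column B E) z) l
      (𝓝 ((a : Column B E →L[ℂ] Column B E) z)) := by
  -- The vector `z` equals `z ⟨(1, 0), (1, 0)⟩`, the value of a rank-one operator. This is where the
  -- unit of `B` is needed.
  have := h.apply (rankOne_mem_compacts z (inl 1)) (inl 1)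
  have h1 : (rankOne B z (inl 1) : Column B E →L[ℂ] Column B E) (inl 1) = z := by
    rw [rankOne_apply]
    have : ip B (inl 1 : Column B E) (inl 1) = 1 := by
      change Star.star (1 : B) * 1 + ip B (0 : E) 0 = 1
      simp [← ipₛₗ_apply]
    rw [this]
    exact ext_inner Bᵐᵒᵖ fun w => by rw [CStarModule.inner_op_smul_right, op_one, one_mul]
  rwa [h1] at this

end Strict

/-! ### Positivity of operator matrices from their quadratic forms -/

section Positivity

variable {A : Type*} [NonUnitalCStarAlgebra A] [PartialOrder A] [StarOrderedRing A]
variable {H : Type*} [NormedAddCommGroup H] [NormedSpace ℂ H] [SMul A H] [CStarModule A H]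

theorem IsAdjointPair.map_smul {F : Type*} [NormedAddCommGroup F] [NormedSpace ℂ F] [SMul A F]
    [CStarModule A F] {a : H →L[ℂ] F} {b : F →L[ℂ] H} (h : IsAdjointPair A a b) (c : A) (x : H) :
    a (c • x) = c • a x :=
  ext_inner A fun w => by
    rw [← h.symm, CStarModule.inner_op_smul_right, CStarModule.inner_op_smul_right, ← h.symm]

theorem exists_eq_star_mul_self_of_nonneg {D : Type*} [NonUnitalCStarAlgebra D] [PartialOrder D]
    [StarOrderedRing D] {a : D} (ha : 0 ≤ a) : ∃ s, a = star s * s :=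
  CStarAlgebra.nonneg_iff_eq_star_mul_self.1 ha

/-- A self-adjoint matrix over a C⋆-algebra of adjointable operators is positive if its quadratic
form is. -/
theorem cstarMatrix_nonneg_of_inner {D : Type*} [NonUnitalCStarAlgebra D] [PartialOrder D]
    [StarOrderedRing D] (π : D →⋆ₙₐ[ℂ] Adjointable A H) (hπ : Function.Injective π)
    {ι : Type*} [Fintype ι] (M : CStarMatrix ι ι D) (hM : ∀ i j, star (M i j) = M j i)
    (hpos : ∀ v : ι → H, 0 ≤ ∑ i, ∑ j, inner A (v i) ((π (M i j) : H →L[ℂ] H) (v j))) :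
    0 ≤ M := by
  have hMs : IsSelfAdjoint M := by
    ext i j
    rw [CStarMatrix.star_apply, hM]
  obtain ⟨P, R, hPs, hR, h1, hS⟩ := exists_negPart M hMs
  -- Here `P` is the negative part of `M`. The quadratic form is evaluated at the `k`-th column of
  -- `P` applied to `v`; on the other hand `P M P = -(R P)⋆ (R P)` has nonpositive diagonal entries,
  -- which forces `R P = 0`.
  have h2 (k : ι) (v : H) : 0 ≤ inner A v ((π ((P * M * P) k k) : H →L[ℂ] H) v) := by
    convert hpos fun i => (π (P i k) : H →L[ℂ] H) v using 1
    simp only [CStarMatrix.mul_apply, Finset.sum_mul, map_sum, map_mul,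
      AddSubmonoidClass.coe_finsetSum, sum_apply, MulMemClass.coe_mul, mul_apply_eq_comp,
      CStarModule.inner_sum_right, Adjointable.inner_left, ← map_star, ← CStarMatrix.star_apply, hPs]
    rw [Finset.sum_comm]
  have h3 (k l : ι) (v : H) : (π ((R * P) l k) : H →L[ℂ] H) v = 0 := by
    have h4 : ∑ l, inner A ((π ((R * P) l k) : H →L[ℂ] H) v)
        ((π ((R * P) l k) : H →L[ℂ] H) v) = 0 := by
      refine le_antisymm ?_ (Finset.sum_nonneg fun i _ => CStarModule.inner_self_nonneg)
      have := h2 k v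
      rw [h1, CStarMatrix.neg_apply, CStarMatrix.mul_apply, map_neg, map_sum] at this
      simpa [CStarMatrix.star_apply, Adjointable.inner_left, map_star] using this
    rw [Finset.sum_eq_zero_iff_of_nonneg fun i _ => CStarModule.inner_self_nonneg] at h4
    exact CStarModule.inner_self.1 (h4 l (Finset.mem_univ l))
  -- Faithfulness of `π` turns the vanishing on all vectors into the vanishing of the matrix
  -- entries.
  have h5 : R * P = 0 := by
    ext l k
    refine hπ (Subtype.ext (ContinuousLinearMap.ext fun v => ?_))
    rw [h3]
    simp
  have h6 : P = 0 := by
    rw [← CStarRing.star_mul_self_eq_zero_iff, hPs]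
    nth_rewrite 1 [hR]
    rw [mul_assoc, h5, mul_zero]
  obtain ⟨S, rfl⟩ := hS h6
  exact star_mul_self_nonneg S

end Positivity

/-! ### Total sets and amplification in the interior tensor product -/

section TensorTotal

variable {B : Type*} [NonUnitalCStarAlgebra B] [PartialOrder B] [StarOrderedRing B]
variable {E : Type*} [NormedAddCommGroup E] [NormedSpace ℂ E] [SMul Bᵐᵒᵖ E] [CStarModule Bᵐᵒᵖ E]
variable {A : Type*} [NonUnitalCStarAlgebra A] [PartialOrder A] [StarOrderedRing A]
variable {G : Type*} [NormedAddCommGroup G] [NormedSpace ℂ G] [SMul A G] [CStarModule A G]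
variable (φ : B →⋆ₙₐ[ℂ] Adjointable A G)

namespace InteriorTensor

variable (E) in
/-- The canonical map of the algebraic into the interior tensor product. -/
def ofTensor : E ⊗[ℂ] G →ₗ[ℂ] InteriorTensor E φ :=
  (UniformSpace.Completion.toComplL (𝕜 := ℂ) (E := PreTensor E φ)).toLinearMap ∘ₗ PreTensor.mk E φ

theorem inner_ofTensor (s t : E ⊗[ℂ] G) :
    inner A (ofTensor E φ s) (ofTensor E φ t) = tensorForm E φ s t :=
  Completion.inner_coe' ..

theorem denseRange_ofTensor : DenseRange (ofTensor E φ) :=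
  UniformSpace.Completion.denseRange_coe.comp (PreTensor.mk_surjective φ).denseRange
    (UniformSpace.Completion.continuous_coe _)

/-- The elementary tensor as a bilinear map. -/
def tmulₗ : E →ₗ[ℂ] G →ₗ[ℂ] InteriorTensor E φ :=
  (TensorProduct.mk ℂ E G).compr₂ (ofTensor E φ)

/-- Cauchy–Schwarz in `G` applied to `⟨y, φ(⟨x, x⟩) y⟩`. -/
theorem norm_tmul_le (x : E) (y : G) : ‖tmul φ x y‖ ≤ √‖φ (ip B x x)‖ * ‖y‖ := by
  refine abs_le_of_sq_le_sq' ?_ (by positivity) |>.2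
  rw [mul_pow, Real.sq_sqrt (norm_nonneg (φ (ip B x x))), CStarModule.norm_sq_eq A, inner_tmul]
  calc _ ≤ ‖y‖ * (‖φ (ip B x x)‖ * ‖y‖) := (CStarModule.norm_inner_le G).trans
        (by gcongr; exact (φ (ip B x x) : G →L[ℂ] G).le_opNorm y)
    _ = _ := by ring

theorem continuous_tmul_left [CompleteSpace G] (y : G) : Continuous fun x : E => tmul φ x y := by
  refine AddMonoidHomClass.continuous_of_bound ((tmulₗ φ).flip y) ‖y‖ fun x => ?_
  refine (norm_tmul_le φ x y).trans ?_
  rw [mul_comm]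
  refine mul_le_mul_of_nonneg_left ?_ (norm_nonneg _)
  rw [← Real.sqrt_sq (norm_nonneg x), ← norm_ip_self (C := B)]
  exact Real.sqrt_le_sqrt (NonUnitalStarAlgHom.norm_apply_le φ _)

variable (E) in
theorem total_tmul :
    (Submodule.span ℂ (Set.range fun p : E × G => tmul φ p.1 p.2)).topologicalClosure = ⊤ := by
  rw [← Submodule.dense_iff_topologicalClosure_eq_top]
  refine (denseRange_ofTensor (E := E) φ).mono ?_
  rintro _ ⟨t, rfl⟩
  induction t with
  | zero => simp
  | add a b ha hb => rw [map_add]; exact Submodule.add_mem _ ha hb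
  | tmul x y => exact Submodule.subset_span ⟨(x, y), rfl⟩

variable (E) in
-- For fixed `x` the map `y ↦ x ⊙ y` is bounded, so a closed subspace that contains `x ⊙ g s` for
-- all `s` contains `x ⊙ y` for all `y`. It lets operators on `E ⊙ 𝔉` be treated on the vectors `x ⊙
-- (X ⊗ v)` only.
theorem total_tmul_of_total {S : Type*} {g : S → G}
    (hg : (Submodule.span ℂ (Set.range g)).topologicalClosure = ⊤) :
    (Submodule.span ℂ (Set.range fun p : E × S => tmul φ p.1 (g p.2))).topologicalClosure = ⊤ := by
  set W := (Submodule.span ℂ (Set.range fun p : E × S => tmul φ p.1 (g p.2))).topologicalClosure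
    with hW
  have hc : IsClosed (W : Set (InteriorTensor E φ)) := Submodule.isClosed_topologicalClosure _
  refine eq_top_iff.2 fun t _ => mem_of_total (total_tmul E φ) hc ?_ t
  rintro _ ⟨⟨x, y⟩, rfl⟩
  let f : G →L[ℂ] InteriorTensor E φ := (tmulₗ φ x).mkContinuous _ (norm_tmul_le φ x)
  refine mem_of_total hg (W := W.comap f.toLinearMap) (hc.preimage f.continuous) ?_ y
  rintro _ ⟨s, rfl⟩
  exact Submodule.le_topologicalClosure _ (Submodule.subset_span ⟨(x, s), rfl⟩)

/-- The amplification `a ↦ a ⊙ id`. -/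
theorem exists_amplification [CompleteSpace E] :
    ∃ π : Adjointable Bᵐᵒᵖ E →⋆ₙₐ[ℂ] Adjointable A (InteriorTensor E φ), ∀ a x y,
      (π a : InteriorTensor E φ →L[ℂ] InteriorTensor E φ) (tmul φ x y) =
        tmul φ ((a : E →L[ℂ] E) x) y := by
  obtain ⟨π, hπ⟩ := exists_starHom_of_dense (A := A) (denseRange_ofTensor (E := E) φ)
    (fun a : Adjointable Bᵐᵒᵖ E => ((a : E →L[ℂ] E) : E →ₗ[ℂ] E).rTensor G)
    (fun d e t => by simp [LinearMap.rTensor_add])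
    (fun c d t => by simp [LinearMap.rTensor_smul])
    (fun t => by
      rw [OneMemClass.coe_one, ContinuousLinearMap.toLinearMap_one, Module.End.one_eq_id,
        LinearMap.rTensor_id_apply])
    (fun d e t => by
      rw [MulMemClass.coe_mul, ContinuousLinearMap.toLinearMap_mul, Module.End.mul_eq_comp,
        LinearMap.rTensor_comp_apply])
    (fun d s t => by
      rw [inner_ofTensor, inner_ofTensor]
      induction s with
      | zero => simp
      | add a b ha hb => simp [ha, hb]
      | tmul x y =>
        induction t with
        | zero => simp
        | add a b ha hb => simp only [map_add, ha, hb]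
        | tmul x' y' =>
          simp only [LinearMap.rTensor_tmul, tensorForm_tmul, ContinuousLinearMap.coe_coe]
          rw [isAdjointPair_iff.1 (Adjointable.isAdjointPair_star d)])
  exact ⟨π, fun a x y => hπ a (x ⊗ₜ y)⟩

end InteriorTensor

end TensorTotal

/-! ### Compressions are completely positive and strict -/

section Dilation

variable {B : Type*} [CStarAlgebra B] [PartialOrder B] [StarOrderedRing B]
variable {E : Type*} [NormedAddCommGroup E] [NormedSpace ℂ E] [SMul Bᵐᵒᵖ E] [CStarModule Bᵐᵒᵖ E]
  [CompleteSpace E]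
variable {C : Type*} [NonUnitalCStarAlgebra C] [PartialOrder C] [StarOrderedRing C]
variable {F : Type*} [NormedAddCommGroup F] [NormedSpace ℂ F] [SMul Cᵐᵒᵖ F] [CStarModule Cᵐᵒᵖ F]
  [CompleteSpace F]
variable {K : Type*} [NormedAddCommGroup K] [NormedSpace ℂ K] [SMul Cᵐᵒᵖ K] [CStarModule Cᵐᵒᵖ K]

/-- The compression `a ↦ W⋆ a W` of adjointable operators. -/
def compress {W : F →L[ℂ] K} {W' : K →L[ℂ] F} (h : IsAdjointPair Cᵐᵒᵖ W W') :
    Adjointable Cᵐᵒᵖ K →ₗ[ℂ] Adjointable Cᵐᵒᵖ F where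
  toFun a := ⟨W' ∘L (a : K →L[ℂ] K) ∘L W, W' ∘L ((star a : Adjointable Cᵐᵒᵖ K) : K →L[ℂ] K) ∘L W,
    fun _ _ => (h.symm _ _).trans ((Adjointable.isAdjointPair_star a _ _).trans (h _ _))⟩
  map_add' _ _ := Subtype.ext (ContinuousLinearMap.ext fun _ => map_add W' _ _)
  map_smul' c _ := Subtype.ext (ContinuousLinearMap.ext fun _ => map_smul W' c _)

section Compress

variable {W : F →L[ℂ] K} {W' : K →L[ℂ] F} (h : IsAdjointPair Cᵐᵒᵖ W W')

theorem compress_apply (a : Adjointable Cᵐᵒᵖ K) (x : F) :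
    (compress h a : F →L[ℂ] F) x = W' ((a : K →L[ℂ] K) (W x)) := rfl

theorem star_compress (a : Adjointable Cᵐᵒᵖ K) : star (compress h a) = compress h (star a) :=
  Adjointable.star_eq_of_isAdjointPair fun _ _ =>
    (h.symm _ _).trans ((Adjointable.isAdjointPair_star a _ _).trans (h _ _))

theorem norm_compress_le (a : Adjointable Cᵐᵒᵖ K) : ‖compress h a‖ ≤ ‖W'‖ * (‖a‖ * ‖W‖) :=
  (W'.opNorm_comp_le _).trans
    (mul_le_mul_of_nonneg_left ((a : K →L[ℂ] K).opNorm_comp_le W) (norm_nonneg _))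

/-- The source of complete positivity: `W⋆ a⋆ b W` has the quadratic form of a Gram matrix. -/
theorem inner_compress_star_mul (a b : Adjointable Cᵐᵒᵖ K) (x y : F) :
    inner Cᵐᵒᵖ x ((compress h (star a * b) : F →L[ℂ] F) y) =
      inner Cᵐᵒᵖ ((a : K →L[ℂ] K) (W x)) ((b : K →L[ℂ] K) (W y)) := by
  rw [compress_apply, ← h, Adjointable.inner_left]
  rfl

end Compress

namespace LinkingAlgebra

variable (C F) in
/-- The inclusion of the extended linking algebra into the operators on `C ⊕ F`. -/
def toAdjointableHom : LinkingAlgebra C F →⋆ₙₐ[ℂ] Adjointable Cᵐᵒᵖ (Column C F) :=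
  NonUnitalStarSubalgebraClass.subtype (linkingSubalgebra C F)

theorem toAdjointableHom_injective : Function.Injective (toAdjointableHom C F) :=
  Subtype.val_injective

theorem exists_eq_of (X : LinkingAlgebra C F) : ∃ c y z a, X = of c y z a := by
  obtain ⟨_, c, y, z, a, rfl⟩ := X
  exact ⟨c, y, z, a, rfl⟩

theorem norm_toAdjointable (X : LinkingAlgebra C F) : ‖X.toAdjointable‖ = ‖X‖ := rfl

end LinkingAlgebra

/-- A map between extended linking algebras which has the form `X ↦ W⋆ π(X) W` is completely
positive. -/
theorem exists_cp_of_compress {W : Column C F →L[ℂ] K} {W' : K →L[ℂ] Column C F}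
    (h : IsAdjointPair Cᵐᵒᵖ W W') (π : Adjointable Bᵐᵒᵖ (Column B E) →⋆ₙₐ[ℂ] Adjointable Cᵐᵒᵖ K)
    (hmem : ∀ X : LinkingAlgebra B E,
      compress h (π X.toAdjointable) ∈ linkingSubalgebra C F) :
    ∃ Φ : LinkingAlgebra B E →CP LinkingAlgebra C F,
      ∀ X, (Φ X).toAdjointable = compress h (π X.toAdjointable) := by
  let Φ : LinkingAlgebra B E →ₗ[ℂ] LinkingAlgebra C F :=
    { toFun := fun X => ⟨compress h (π X.toAdjointable), hmem X⟩
      map_add' := fun X Y => LinkingAlgebra.toAdjointableHom_injective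
        (congrArg (compress h) (map_add π _ _) |>.trans (map_add _ _ _))
      map_smul' := fun c X => LinkingAlgebra.toAdjointableHom_injective
        (congrArg (compress h) (map_smul π _ _) |>.trans (map_smul _ _ _)) }
  have hΦ (X : LinkingAlgebra B E) : LinkingAlgebra.toAdjointableHom C F (Φ X) =
    compress h (π (LinkingAlgebra.toAdjointableHom B E X)) := rfl
  refine ⟨⟨Φ, fun k M hM => ?_⟩, fun X => rfl⟩
  obtain ⟨S, rfl⟩ := exists_eq_star_mul_self_of_nonneg hM
  refine cstarMatrix_nonneg_of_inner (LinkingAlgebra.toAdjointableHom C F)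
    LinkingAlgebra.toAdjointableHom_injective _ (fun i j => ?_) fun v => ?_
  · apply LinkingAlgebra.toAdjointableHom_injective
    rw [map_star, CStarMatrix.map_apply, CStarMatrix.map_apply, hΦ, hΦ, star_compress, ← map_star,
      ← map_star, ← CStarMatrix.star_apply, star_mul, star_star]
  -- For the positive matrix `S⋆ S` the quadratic form of the image is a sum over `l` of the squares
  -- of `∑ i, π(S l i) W (v i)`.
  · have : ∑ i, ∑ j, inner Cᵐᵒᵖ (v i) ((LinkingAlgebra.toAdjointableHom C F
        ((star S * S).map Φ i j) : Column C F →L[ℂ] Column C F) (v j)) =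
        ∑ l, inner Cᵐᵒᵖ
          (∑ i, (π (LinkingAlgebra.toAdjointableHom B E (S l i)) : K →L[ℂ] K) (W (v i)))
          (∑ i, (π (LinkingAlgebra.toAdjointableHom B E (S l i)) : K →L[ℂ] K) (W (v i))) := by
      simp only [CStarMatrix.map_apply, hΦ, CStarMatrix.mul_apply, CStarMatrix.star_apply, map_sum,
        map_mul, map_star, AddSubmonoidClass.coe_finsetSum, sum_apply, CStarModule.inner_sum_right,
        CStarModule.inner_sum_left, inner_compress_star_mul]
      conv_lhs =>
        enter [2, x]
        rw [Finset.sum_comm]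
      rw [Finset.sum_comm]
      refine Finset.sum_congr rfl fun _ _ => Finset.sum_comm
    rw [this]
    exact Finset.sum_nonneg fun l _ => CStarModule.inner_self_nonneg

/-- A completely positive map of the form `X ↦ W⋆ (X ⊙ id) W` is strict. -/
theorem isStrict_of_compress {G : Type*} [NormedAddCommGroup G] [NormedSpace ℂ G] [SMul Cᵐᵒᵖ G]
    [CStarModule Cᵐᵒᵖ G] [CompleteSpace G] {φ : B →⋆ₙₐ[ℂ] Adjointable Cᵐᵒᵖ G}
    {W : Column C F →L[ℂ] InteriorTensor (Column B E) φ}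
    {W' : InteriorTensor (Column B E) φ →L[ℂ] Column C F} (h : IsAdjointPair Cᵐᵒᵖ W W')
    {π : Adjointable Bᵐᵒᵖ (Column B E) →⋆ₙₐ[ℂ]
      Adjointable Cᵐᵒᵖ (InteriorTensor (Column B E) φ)}
    (hπ : ∀ a x y, (π a : InteriorTensor (Column B E) φ →L[ℂ] InteriorTensor (Column B E) φ)
      (InteriorTensor.tmul φ x y) =
        InteriorTensor.tmul φ ((a : Column B E →L[ℂ] Column B E) x) y)
    {Φ : LinkingAlgebra B E → LinkingAlgebra C F}
    (hΦ : ∀ X, (Φ X).toAdjointable = compress h (π X.toAdjointable)) : IsStrict Φ := by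
  rintro l X ⟨M, hM⟩ hX
  -- Stated for an arbitrary bounded strictly convergent family, since it is needed both for `Y` and
  -- for its adjoint. On elementary tensors it reduces to pointwise convergence in `B ⊕ E`.
  have key {u : LinkingAlgebra B E → Adjointable Bᵐᵒᵖ (Column B E)}
      {a : Adjointable Bᵐᵒᵖ (Column B E)} (hu : ∀ᶠ Y in l, ‖u Y‖ ≤ M)
      (hua : TendstoStrictly B u l a) (z : Column C F) :
      Tendsto (fun Y => (compress h (π (u Y)) : Column C F →L[ℂ] Column C F) z) l
        (𝓝 ((compress h (π a) : Column C F →L[ℂ] Column C F) z)) := by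
    simp only [compress_apply]
    refine (W'.continuous.tendsto _).comp ?_
    refine tendsto_apply_of_mem_closure (G' := InteriorTensor (Column B E) φ)
      (f := fun Y => (π (u Y) : InteriorTensor (Column B E) φ →L[ℂ] InteriorTensor (Column B E) φ))
      (M := M) (hu.mono fun Y hY => (NonUnitalStarAlgHom.norm_apply_le π (u Y)).trans hY) ?_
      (InteriorTensor.total_tmul (Column B E) φ ▸ Submodule.mem_top)
    rintro _ ⟨⟨x, y⟩, rfl⟩
    simp only [hπ]
    exact ((InteriorTensor.continuous_tmul_left φ y).tendsto _).comp (hua.apply_column x)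
  refine tendstoStrictly_of_pointwise (M := ‖W'‖ * (M * ‖W‖)) ?_ (fun z => ?_) fun z => ?_
  · filter_upwards [hM] with Y hY
    rw [hΦ]
    refine (norm_compress_le h _).trans ?_
    gcongr
    exact (NonUnitalStarAlgHom.norm_apply_le π _).trans hY
  · simp only [hΦ]
    exact key hM hX z
  · simp only [hΦ, star_compress, ← map_star]
    exact key (by simpa only [norm_star_adjointable, LinkingAlgebra.norm_toAdjointable] using hM)
      hX.star z

end Dilation

/-! ### From a factorization to a strict completely positive extension -/

section OfDilation

open InteriorTensor

variable {B : Type*} [CStarAlgebra B] [PartialOrder B] [StarOrderedRing B]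
variable {E : Type*} [NormedAddCommGroup E] [NormedSpace ℂ E] [SMul Bᵐᵒᵖ E] [CStarModule Bᵐᵒᵖ E]
  [CompleteSpace E]
variable {C : Type*} [NonUnitalCStarAlgebra C] [PartialOrder C] [StarOrderedRing C]
variable {F : Type*} [NormedAddCommGroup F] [NormedSpace ℂ F] [SMul Cᵐᵒᵖ F] [CStarModule Cᵐᵒᵖ F]
  [CompleteSpace F]
variable {G : Type*} [NormedAddCommGroup G] [NormedSpace ℂ G] [SMul Cᵐᵒᵖ G] [CStarModule Cᵐᵒᵖ G]
  [CompleteSpace G]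
variable {K : Type*} [NormedAddCommGroup K] [NormedSpace ℂ K] [SMul Cᵐᵒᵖ K] [CStarModule Cᵐᵒᵖ K]

theorem ip_inl_one (w : Column B E) : ip B (inl 1) w = prl w := by
  rw [ip_column]
  change star (1 : B) * w.1 + ip B (0 : E) w.2 = w.1
  simp [← ipₛₗ_apply]

theorem ip_inr (x : E) (w : Column B E) : ip B (inr x) w = ip B x (prr w) := by
  rw [ip_column]
  change star (0 : B) * w.1 + ip B x w.2 = ip B x w.2
  simp

theorem block_inl_one (b : B) (x' x : E) (a : Adjointable Bᵐᵒᵖ E) :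
    (block b x' x a : Column B E →L[ℂ] Column B E) (inl 1) = inl b + inr x := by
  refine column_ext ?_ ?_
  · change b * 1 + ip B x' 0 = b + 0
    simp [← ipₛₗ_apply]
  · change op (1 : B) • x + (a : E →L[ℂ] E) 0 = 0 + x
    rw [map_zero, add_zero, zero_add]
    exact ext_inner Bᵐᵒᵖ fun w => by rw [CStarModule.inner_op_smul_right, op_one, one_mul]

theorem block_inr (b : B) (x' x : E) (a : Adjointable Bᵐᵒᵖ E) (z : E) :
    (block b x' x a : Column B E →L[ℂ] Column B E) (inr z) =
      inl (ip B x' z) + inr ((a : E →L[ℂ] E) z) := by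
  refine column_ext ?_ ?_
  · change b * 0 + ip B x' z = ip B x' z + 0
    simp
  · change op (0 : B) • x + (a : E →L[ℂ] E) z = 0 + (a : E →L[ℂ] E) z
    rw [← ket_apply, map_zero]

theorem block_congr {c c' : C} {y y' z z' : F} {a a' : Adjointable Cᵐᵒᵖ F} (hc : c = c')
    (hy : y = y') (hz : z = z') (ha : a = a') : block c y z a = block c' y' z' a' := by
  rw [hc, hy, hz, ha]

/-- The adjoint of the operator `C ⊕ F → K` with components `c ↦ η c` and `V`. -/
theorem isAdjointPair_row (η : K) {V : F →L[ℂ] K} {V' : K →L[ℂ] F}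
    (h : IsAdjointPair Cᵐᵒᵖ V V') :
    IsAdjointPair Cᵐᵒᵖ (ket C η ∘L prl + V ∘L prr) (inl ∘L bra C η + inr ∘L V') := by
  rw [isAdjointPair_iff] at h ⊢
  intro v k
  change ip C (ket C η v.1 + V v.2) k = star v.1 * (ip C η k + 0) + ip C v.2 (0 + V' k)
  rw [ip_add_left, ip_ket, h, add_zero, zero_add]

/-- Expand `W (c, y) = η c + V y` and use that adjointable operators are linear over `C`. The second
slot of `block` stores a vector whose adjoint is the entry, so `⟨η, X V y⟩` appears there through
`V⋆ X⋆ η`. -/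
theorem compress_row_eq_block {η : K} {V : F →L[ℂ] K} {V' : K →L[ℂ] F}
    (h : IsAdjointPair Cᵐᵒᵖ V V') (X : Adjointable Cᵐᵒᵖ K) :
    compress (isAdjointPair_row η h) X = block (ip C η ((X : K →L[ℂ] K) η))
      (V' (((star X : Adjointable Cᵐᵒᵖ K) : K →L[ℂ] K) η)) (V' ((X : K →L[ℂ] K) η))
      (compress h X) := by
  refine block_ext (fun v => ?_) fun v => ?_
  · change ip C η ((X : K →L[ℂ] K) (op v.1 • η + V v.2)) + 0 =
      ip C η ((X : K →L[ℂ] K) η) * v.1 + ip C (V' _) v.2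
    rw [map_add, map_op_smul, ip_add_right, ip_smul_right, add_zero, isAdjointPair_iff.1 h.symm,
      ip_star_apply]
  · change 0 + V' ((X : K →L[ℂ] K) (op v.1 • η + V v.2)) = op v.1 • V' _ + V' _
    rw [map_add, map_op_smul, map_add, h.symm.map_smul, zero_add]
    rfl

/-- The adjointable embedding `V = (inr ⊙ id) ξ₂` of `F` into `(B ⊕ E) ⊙ G`. -/
theorem exists_inr_tensor (φ : B →⋆ₙₐ[ℂ] Adjointable Cᵐᵒᵖ G)
    {ξ₂ : F →L[ℂ] InteriorTensor E φ} {ξ₂' : InteriorTensor E φ →L[ℂ] F}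
    (h : IsAdjointPair Cᵐᵒᵖ ξ₂ ξ₂') :
    ∃ (J : InteriorTensor E φ →L[ℂ] InteriorTensor (Column B E) φ)
      (V' : InteriorTensor (Column B E) φ →L[ℂ] F),
      (∀ x y, J (tmul φ x y) = tmul φ (inr x) y) ∧ IsAdjointPair Cᵐᵒᵖ (J ∘L ξ₂) V' ∧
      ∀ w y, V' (tmul φ w y) = ξ₂' (tmul φ (prr w) y) := by
  obtain ⟨J, hJ, -⟩ := exists_isometry_of_gram_eq (A := Cᵐᵒᵖ) (total_tmul E φ)
    (g' := fun p : E × G => tmul φ (inr (C := B) p.1) p.2) fun p q => by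
      rw [inner_tmul, inner_tmul, ip_inr]; rfl
  replace hJ (x : E) (y : G) : J (tmul φ x y) = tmul φ (inr (C := B) x) y := hJ (x, y)
  -- The formal adjoint of `J = inr ⊙ id` is `prr ⊙ id`. It is needed only on elementary tensors,
  -- and the adjoint of `J ξ₂` is then obtained on a total set.
  have hJw (t : InteriorTensor E φ) (w : Column B E) (y : G) :
      inner Cᵐᵒᵖ (J t) (tmul φ w y) = inner Cᵐᵒᵖ t (tmul φ (prr w) y) := by
    refine inner_eq_of_total (A := Cᵐᵒᵖ) (total_tmul E φ) J ?_ t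
    rintro _ ⟨⟨z, f⟩, rfl⟩
    change inner Cᵐᵒᵖ (J (tmul φ z f)) (tmul φ w y) = inner Cᵐᵒᵖ (tmul φ z f) (tmul φ (prr w) y)
    rw [hJ, inner_tmul, inner_tmul, ip_inr]
  have hr (u : F) (w : Column B E) (y : G) : inner Cᵐᵒᵖ ((J ∘L ξ₂) u) (tmul φ w y) =
      inner Cᵐᵒᵖ u (ξ₂' (tmul φ (prr w) y)) := (hJw _ _ _).trans (h _ _)
  obtain ⟨V', hV⟩ := exists_adjoint_of_total (total_tmul (Column B E) φ) (J ∘L ξ₂) (by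
    rintro _ ⟨⟨w, y⟩, rfl⟩
    exact ⟨_, fun u => hr u w y⟩)
  exact ⟨J, V', hJ, hV, fun w y => ext_inner Cᵐᵒᵖ fun u => by rw [← hV, hr]⟩

/-- The compression of `X ⊙ id` to `F` depends only on the lower right corner of `X`. -/
theorem compress_corner {φ : B →⋆ₙₐ[ℂ] Adjointable Cᵐᵒᵖ G}
    {π : Adjointable Bᵐᵒᵖ (Column B E) →⋆ₙₐ[ℂ]
      Adjointable Cᵐᵒᵖ (InteriorTensor (Column B E) φ)}
    (hπ : ∀ a x y, (π a : InteriorTensor (Column B E) φ →L[ℂ] InteriorTensor (Column B E) φ)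
      (tmul φ x y) = tmul φ ((a : Column B E →L[ℂ] Column B E) x) y)
    {ξ₂ : F →L[ℂ] InteriorTensor E φ} {ξ₂' : InteriorTensor E φ →L[ℂ] F}
    {J : InteriorTensor E φ →L[ℂ] InteriorTensor (Column B E) φ}
    {V' : InteriorTensor (Column B E) φ →L[ℂ] F}
    (hJ : ∀ x y, J (tmul φ x y) = tmul φ (inr x) y) (hV : IsAdjointPair Cᵐᵒᵖ (J ∘L ξ₂) V')
    (hV' : ∀ w y, V' (tmul φ w y) = ξ₂' (tmul φ (prr w) y)) (b : B) (x' x : E)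
    (a : Adjointable Bᵐᵒᵖ E) :
    compress hV (π (block b x' x a)) = compress hV (π (block 0 0 0 a)) := by
  have (X : Adjointable Bᵐᵒᵖ (Column B E)) (z : E) (y : G) :
      V' ((π X : InteriorTensor (Column B E) φ →L[ℂ] InteriorTensor (Column B E) φ)
        (J (tmul φ z y))) = ξ₂' (tmul φ (prr ((X : Column B E →L[ℂ] Column B E) (inr z))) y) := by
    rw [hJ, hπ, hV']
  -- The values of `ξ₂` need not be elementary tensors, so the equality is established on all of `E
  -- ⊙ G` before composing with `ξ₂`. On `z ⊙ y` both sides see only `prr (X (0, z)) = a z`.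
  have : V' ∘L (π (block b x' x a) : InteriorTensor (Column B E) φ →L[ℂ] _) ∘L J =
      V' ∘L (π (block 0 0 0 a) : InteriorTensor (Column B E) φ →L[ℂ] _) ∘L J := by
    refine eq_of_total (total_tmul E φ) ?_
    rintro _ ⟨⟨z, y⟩, rfl⟩
    refine (this _ z y).trans (Eq.trans ?_ (this _ z y).symm)
    rw [block_inr, block_inr]
    rfl
  exact Subtype.ext (ContinuousLinearMap.ext fun u => DFunLike.congr_fun this (ξ₂ u))

/-- The extension is the compression of `X ⊙ id` by the row with entries `η = (1, 0) ⊙ ξ₁` and `V =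
(inr ⊙ id) ξ₂`. Since `X (1, 0) = (b, x)` and `V⋆` forgets the first component, the lower left
corner is `ξ₂⋆ (x ⊙ ξ₁)`. -/
theorem exists_cp_extension (φ : B →⋆ₙₐ[ℂ] Adjointable Cᵐᵒᵖ G) (ξ₁ : G)
    {ξ₂ : F →L[ℂ] InteriorTensor E φ} {ξ₂' : InteriorTensor E φ →L[ℂ] F}
    (h : IsAdjointPair Cᵐᵒᵖ ξ₂ ξ₂') :
    ∃ (τ : B → C) (θ : Adjointable Bᵐᵒᵖ E → Adjointable Cᵐᵒᵖ F)
      (Φ : LinkingAlgebra B E →CP LinkingAlgebra C F), IsStrict Φ ∧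
        ∀ (b : B) (x' x : E) (a : Adjointable Bᵐᵒᵖ E), Φ (LinkingAlgebra.of b x' x a) =
          LinkingAlgebra.of (τ b) (ξ₂' (tmul φ x' ξ₁)) (ξ₂' (tmul φ x ξ₁)) (θ a) := by
  obtain ⟨π, hπ⟩ := exists_amplification (E := Column B E) φ
  obtain ⟨J, V', hJ, hV, hV'⟩ := exists_inr_tensor φ h
  have hη (b : B) (x' x : E) (a : Adjointable Bᵐᵒᵖ E) :
      (π (block b x' x a) : InteriorTensor (Column B E) φ →L[ℂ] InteriorTensor (Column B E) φ)
        (tmul φ (inl 1) ξ₁) = tmul φ (inl b + inr x) ξ₁ := by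
    rw [hπ, block_inl_one]
  have hV2 (b : B) (x : E) : V' (tmul φ (inl b + inr x) ξ₁) = ξ₂' (tmul φ x ξ₁) :=
    (hV' _ _).trans (congrArg (fun x => ξ₂' (tmul φ x ξ₁)) (zero_add x))
  have hτ (b : B) (x : E) : ip C (tmul φ (inl 1) ξ₁) (tmul φ (inl b + inr x) ξ₁) =
      ip C ξ₁ ((φ b : G →L[ℂ] G) ξ₁) := by
    rw [ip, inner_tmul, ip_inl_one]
    exact congrArg (fun b => ip C ξ₁ ((φ b : G →L[ℂ] G) ξ₁)) (add_zero b)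
  have hblock (b : B) (x' x : E) (a : Adjointable Bᵐᵒᵖ E) :
      compress (isAdjointPair_row (tmul φ (inl 1) ξ₁) hV) (π (block b x' x a)) =
        block (ip C ξ₁ ((φ b : G →L[ℂ] G) ξ₁)) (ξ₂' (tmul φ x' ξ₁)) (ξ₂' (tmul φ x ξ₁))
          (compress hV (π (block 0 0 0 a))) := by
    refine (compress_row_eq_block hV _).trans (block_congr ?_ ?_ ?_
      (compress_corner hπ hJ hV hV' b x' x a))
    · exact (congrArg (ip C _) (hη b x' x a)).trans (hτ b x)
    -- Passing to `X⋆` interchanges `x` and `x'`.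
    · rw [← map_star π, star_block]
      exact (congrArg V' (hη (star b) x x' (star a))).trans (hV2 (star b) x')
    · exact (congrArg V' (hη b x' x a)).trans (hV2 b x)
  obtain ⟨Φ, hΦ⟩ := exists_cp_of_compress (isAdjointPair_row (tmul φ (inl 1) ξ₁) hV) π (by
    rintro ⟨_, b, x', x, a, rfl⟩
    exact ⟨_, _, _, _, hblock b x' x a⟩)
  exact ⟨_, _, Φ, isStrict_of_compress _ hπ hΦ, fun b x' x a =>
    LinkingAlgebra.toAdjointableHom_injective ((hΦ _).trans (hblock b x' x a))⟩

end OfDilation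

/-! ### Hilbert modules from positive semidefinite forms -/

section SemiForm

/-- A positive semidefinite `A`-valued form on a vector space with an action of `A`. -/
structure SemiForm (A V : Type*) [NonUnitalCStarAlgebra A] [PartialOrder A] [StarOrderedRing A]
    [AddCommGroup V] [Module ℂ V] where
  /-- The form. -/
  form : V →ₗ⋆[ℂ] V →ₗ[ℂ] A
  /-- The action. -/
  act : A → V →ₗ[ℂ] V
  star_form : ∀ s t, star (form s t) = form t s
  form_self_nonneg : ∀ t, 0 ≤ form t t
  form_act : ∀ a s t, form s (act a t) = a * form s t

variable {A V : Type*} [NonUnitalCStarAlgebra A] [PartialOrder A] [StarOrderedRing A]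
  [AddCommGroup V] [Module ℂ V] (f : SemiForm A V)

namespace SemiForm

/-- The null space of a positive semidefinite form. -/
def null : Submodule ℂ V where
  carrier := {s | ∀ t, f.form t s = 0}
  add_mem' ha hb t := by rw [map_add, ha, hb, add_zero]
  zero_mem' t := map_zero _
  smul_mem' c a ha t := by rw [map_smul, ha, smul_zero]

/-- With `c = ⟨t, s⟩` and `⟨s, s⟩ = 0`, positivity of the form at `t - n (c⋆ s)` bounds `n c⋆ c` by
`⟨t, t⟩` for every `n`, so `c = 0`. -/
theorem mem_null_of_self {s : V} (hs : f.form s s = 0) : s ∈ f.null := by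
  intro t
  set c := f.form t s with hc
  have hc' : f.form s t = star c := by rw [hc, star_form]
  have h1 : f.form t (f.act (star c) s) = star c * c := f.form_act ..
  have h2 : f.form (f.act (star c) s) t = star c * c := by
    rw [← star_form, h1, star_mul, star_star]
  have h3 : f.form (f.act (star c) s) (f.act (star c) s) = 0 := by
    rw [form_act, ← star_form, form_act, hs, mul_zero, star_zero, mul_zero]
  have key (n : ℕ) : n • (star c * c) ≤ f.form t t := by
    have h := f.form_self_nonneg (t - n • f.act (star c) s)
    simp only [map_sub, map_nsmul, LinearMap.sub_apply, LinearMap.smul_apply, h1, h2, h3] at h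
    have h4 : 0 ≤ n • (star c * c) := nsmul_nonneg (star_mul_self_nonneg c) n
    rw [smul_zero, sub_zero, sub_sub, ← sub_nonneg.symm] at h
    exact le_trans (le_add_of_nonneg_left h4) h
  have hn (n : ℕ) : (n : ℝ) * ‖star c * c‖ ≤ ‖f.form t t‖ := by
    have := CStarAlgebra.norm_le_norm_of_nonneg_of_le
      (nsmul_nonneg (star_mul_self_nonneg c) n) (key n)
    rwa [← Nat.cast_smul_eq_nsmul ℂ, norm_smul, Complex.norm_natCast] at this
  by_contra hne
  have hpos : 0 < ‖star c * c‖ :=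
    norm_pos_iff.2 fun h => hne ((CStarRing.star_mul_self_eq_zero_iff c).1 h)
  obtain ⟨n, hn'⟩ := exists_nat_gt (‖f.form t t‖ / ‖star c * c‖)
  rw [div_lt_iff₀ hpos] at hn'
  exact absurd (hn n) (not_le.2 hn')

/-- The quotient by the null space. -/
def Quot : Type _ := V ⧸ f.null

namespace Quot

instance : AddCommGroup f.Quot := inferInstanceAs (AddCommGroup (V ⧸ f.null))
instance : Module ℂ f.Quot := inferInstanceAs (Module ℂ (V ⧸ f.null))

/-- The quotient map. -/
def mk : V →ₗ[ℂ] f.Quot := f.null.mkQ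

theorem mk_surjective : Function.Surjective (mk f) := f.null.mkQ_surjective

instance : SMul A f.Quot where
  smul a := f.null.mapQ f.null (f.act a) fun s hs t => by rw [form_act, hs, mul_zero]

/-- The inner product of the quotient. -/
def form (p q : f.Quot) : A :=
  f.null.liftQ (LinearMap.flip <| f.null.liftQ (LinearMap.flip f.form)
      fun s hs => LinearMap.ext fun t => hs t)
    (fun s hs => LinearMap.ext fun q => by
      obtain ⟨t, rfl⟩ := mk_surjective f q
      change f.form s t = 0
      rw [← star_form, hs, star_zero]) p q

theorem form_mk (s t : V) : form f (mk f s) (mk f t) = f.form s t := rfl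

instance : Norm f.Quot where
  norm x := √‖form f x x‖

instance : CStarModule A f.Quot where
  inner := form f
  inner_add_right {x y z} := by
    obtain ⟨x, rfl⟩ := mk_surjective f x
    obtain ⟨y, rfl⟩ := mk_surjective f y
    obtain ⟨z, rfl⟩ := mk_surjective f z
    rw [← map_add, form_mk, form_mk, form_mk, map_add]
  inner_self_nonneg {x} := by
    obtain ⟨x, rfl⟩ := mk_surjective f x
    exact f.form_self_nonneg x
  inner_self {x} := by
    obtain ⟨x, rfl⟩ := mk_surjective f x
    refine ⟨fun h => (Submodule.Quotient.mk_eq_zero _).2 (f.mem_null_of_self h), fun h => ?_⟩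
    exact (Submodule.Quotient.mk_eq_zero f.null).1 h x
  inner_op_smul_right {a x y} := by
    obtain ⟨x, rfl⟩ := mk_surjective f x
    obtain ⟨y, rfl⟩ := mk_surjective f y
    exact f.form_act a x y
  inner_smul_right_complex {c x y} := by
    obtain ⟨x, rfl⟩ := mk_surjective f x
    obtain ⟨y, rfl⟩ := mk_surjective f y
    rw [← map_smul, form_mk, form_mk, map_smul]
  star_inner x y := by
    obtain ⟨x, rfl⟩ := mk_surjective f x
    obtain ⟨y, rfl⟩ := mk_surjective f y
    exact f.star_form x y
  norm_eq_sqrt_norm_inner_self x := rfl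

instance : NormedAddCommGroup f.Quot := CStarModule.normedAddCommGroup A
instance : NormedSpace ℂ f.Quot := .ofCore (CStarModule.normedSpaceCore A)
instance : UniformContinuousConstSMul A f.Quot := uniformContinuousConstSMul

end Quot

/-- The Hilbert module of a positive semidefinite form. -/
abbrev Hilb : Type _ := UniformSpace.Completion f.Quot

/-- The canonical map into the Hilbert module of a form. -/
def toHilb : V →ₗ[ℂ] f.Hilb :=
  (UniformSpace.Completion.toComplL (𝕜 := ℂ) (E := f.Quot)).toLinearMap ∘ₗ Quot.mk f

theorem inner_toHilb (s t : V) : inner A (f.toHilb s) (f.toHilb t) = f.form s t :=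
  Completion.inner_coe' ..

theorem denseRange_toHilb : DenseRange f.toHilb :=
  UniformSpace.Completion.denseRange_coe.comp (Quot.mk_surjective f).denseRange
    (UniformSpace.Completion.continuous_coe _)

end SemiForm

end SemiForm

/-! ### The GNS module of a completely positive map, cut by an element `P` -/

section Gns

variable {A : Type*} [NonUnitalCStarAlgebra A] [PartialOrder A] [StarOrderedRing A]
variable {H : Type*} [NormedAddCommGroup H] [NormedSpace ℂ H] [SMul A H] [CStarModule A H]
variable {D : Type*} [NonUnitalCStarAlgebra D]

/-- A completely positive map into the adjointable operators, in terms of quadratic forms. -/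
structure CPForm (D A H : Type*) [NonUnitalCStarAlgebra D] [NonUnitalCStarAlgebra A]
    [PartialOrder A] [StarOrderedRing A] [NormedAddCommGroup H] [NormedSpace ℂ H] [SMul A H]
    [CStarModule A H] where
  /-- The underlying linear map. -/
  map : D →ₗ[ℂ] Adjointable A H
  map_star : ∀ X, map (star X) = star (map X)
  -- The factor `P` is part of the condition because `X ↦ P X` need not be injective, so a mere
  -- change of the finite set of pairs would not absorb it.
  nonneg : ∀ (s : Finset (D × H)) (P : D),
    0 ≤ ∑ i ∈ s, ∑ j ∈ s, inner A i.2 ((map (star (P * i.1) * (P * j.1)) : H →L[ℂ] H) j.2)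

namespace CPForm

variable (Ψ : CPForm D A H) (P : D)

/-- The form on `D ⊗ H` which is determined by
`⟨X ⊗ v, Y ⊗ w⟩ = ⟨v, Ψ((P X)⋆ (P Y)) w⟩`. -/
def form : (D ⊗[ℂ] H) →ₗ⋆[ℂ] (D ⊗[ℂ] H) →ₗ[ℂ] A :=
  TensorProduct.lift <| LinearMap.mk₂'ₛₗ (starRingEnd ℂ) (starRingEnd ℂ)
    (fun X v => TensorProduct.lift <| LinearMap.mk₂ ℂ
      (fun Y w => inner A v ((Ψ.map (star (P * X) * (P * Y)) : H →L[ℂ] H) w))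
      (fun x₁ x₂ y' => by simp [mul_add])
      (fun c x' y' => by
        rw [mul_smul_comm c P x', mul_smul_comm c (star (P * X)) (P * x')]; simp)
      (fun x' y₁ y₂ => by simp)
      (fun c x' y' => by simp))
    (fun x₁ x₂ y => TensorProduct.ext' fun x' y' => by simp [mul_add, add_mul])
    (fun c x y => TensorProduct.ext' fun x' y' => by
      simp [mul_smul_comm c P x, -star_mul,
        smul_mul_assoc (starRingEnd ℂ c) (star (P * x)) (P * x')])
    (fun x y₁ y₂ => TensorProduct.ext' fun x' y' => CStarModule.inner_add_left)
    (fun c x y => TensorProduct.ext' fun x' y' => CStarModule.inner_smul_left_complex)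

theorem form_tmul (X Y : D) (v w : H) : Ψ.form P (X ⊗ₜ v) (Y ⊗ₜ w) =
    inner A v ((Ψ.map (star (P * X) * (P * Y)) : H →L[ℂ] H) w) := rfl

/-- The positive semidefinite form of the GNS construction. -/
def semiForm : SemiForm A (D ⊗[ℂ] H) where
  form := Ψ.form P
  act a := (smulₗ a).lTensor D
  star_form t s := by
    induction t with
    | zero => simp
    | add a b ha hb => simp [ha, hb]
    | tmul x y =>
      induction s with
      | zero => simp
      | add a b ha hb => simp [ha, hb]
      | tmul x' y' =>
        rw [form_tmul, form_tmul, CStarModule.star_inner, Adjointable.inner_left, ← Ψ.map_star,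
          star_mul, star_star]
  form_self_nonneg t := by
    obtain ⟨s, rfl⟩ := TensorProduct.exists_finset t
    convert Ψ.nonneg s P using 1
    simp only [map_sum, LinearMap.sum_apply, form_tmul]
    exact Finset.sum_comm
  form_act a t s := by
    induction t with
    | zero => simp
    | add a b ha hb => simp [ha, hb, mul_add]
    | tmul x y =>
      induction s with
      | zero => simp
      | add a b ha hb => simp [ha, hb, mul_add]
      | tmul x' y' =>
        rw [LinearMap.lTensor_tmul, form_tmul, form_tmul, smulₗ_apply,
          ← star_star (Ψ.map _), ← Adjointable.inner_left, ← Adjointable.inner_left,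
          CStarModule.inner_op_smul_right]

/-- The GNS module. -/
abbrev Gns : Type _ := (Ψ.semiForm P).Hilb

/-- The generating vectors `X ⊗ v` of the GNS module. -/
def gvec (X : D) (v : H) : Ψ.Gns P := (Ψ.semiForm P).toHilb (X ⊗ₜ v)

/-- The generating vectors as a bilinear map. -/
def gvecₗ : D →ₗ[ℂ] H →ₗ[ℂ] Ψ.Gns P := (TensorProduct.mk ℂ D H).compr₂ (Ψ.semiForm P).toHilb

theorem gvecₗ_apply (X : D) (v : H) : Ψ.gvecₗ P X v = Ψ.gvec P X v := rfl

theorem inner_gvec (X Y : D) (v w : H) : inner A (Ψ.gvec P X v) (Ψ.gvec P Y w) =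
    inner A v ((Ψ.map (star (P * X) * (P * Y)) : H →L[ℂ] H) w) :=
  SemiForm.inner_toHilb _ _ _

theorem total_gvec :
    (Submodule.span ℂ (Set.range fun p : D × H => Ψ.gvec P p.1 p.2)).topologicalClosure = ⊤ := by
  rw [← Submodule.dense_iff_topologicalClosure_eq_top]
  refine (Ψ.semiForm P).denseRange_toHilb.mono ?_
  rintro _ ⟨t, rfl⟩
  induction t with
  | zero => simp
  | add a b ha hb => rw [map_add]; exact Submodule.add_mem _ ha hb
  | tmul x y => exact Submodule.subset_span ⟨(x, y), rfl⟩

/-- The form sees `X` only through `P X`. For `P = cornerLeft 1` this says that only the first row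
of `X` matters. -/
theorem gvec_congr {X Y : D} (h : P * X = P * Y) (v : H) : Ψ.gvec P X v = Ψ.gvec P Y v := by
  rw [← sub_eq_zero, ← CStarModule.inner_self (A := A)]
  rw [CStarModule.inner_sub_left, CStarModule.inner_sub_right, CStarModule.inner_sub_right,
    inner_gvec, inner_gvec, inner_gvec, inner_gvec, h]
  simp

/-- Cauchy–Schwarz in `H`. The vector `Ψ(⋯) v` is kept in the bound, instead of the norm of the
operator, because strictness controls such operators only on certain vectors. -/
theorem norm_gvec_sq_le (X : D) (v : H) :
    ‖Ψ.gvec P X v‖ ^ 2 ≤ ‖v‖ * ‖(Ψ.map (star (P * X) * (P * X)) : H →L[ℂ] H) v‖ := by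
  rw [CStarModule.norm_sq_eq A, inner_gvec]
  exact CStarModule.norm_inner_le H

theorem continuous_gvec_right (X : D) : Continuous (Ψ.gvec P X) := by
  refine AddMonoidHomClass.continuous_of_bound (Ψ.gvecₗ P X)
    (√‖Ψ.map (star (P * X) * (P * X))‖) fun v => ?_
  refine abs_le_of_sq_le_sq' ?_ (by positivity) |>.2
  rw [gvecₗ_apply, mul_pow, Real.sq_sqrt (norm_nonneg (Ψ.map _))]
  refine (Ψ.norm_gvec_sq_le P X v).trans ?_
  calc _ ≤ ‖v‖ * (‖Ψ.map (star (P * X) * (P * X))‖ * ‖v‖) := by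
        gcongr; exact (Ψ.map (star (P * X) * (P * X)) : H →L[ℂ] H).le_opNorm v
    _ = _ := by ring

theorem continuous_gvec_left (hΨ : Continuous Ψ.map) (v : H) :
    Continuous fun X => Ψ.gvec P X v := by
  -- By linearity it suffices to look at `0`, where the bound is the square root of a continuous
  -- function vanishing there.
  refine continuous_of_continuousAt_zero (Ψ.gvecₗ P |>.flip v) ?_
  rw [ContinuousAt, map_zero, tendsto_zero_iff_norm_tendsto_zero]
  have h1 : Continuous fun X => √(‖v‖ * ‖(Ψ.map (star (P * X) * (P * X)) : H →L[ℂ] H) v‖) := by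
    have : Continuous fun X => (Ψ.map (star (P * X) * (P * X)) : H →L[ℂ] H) v :=
      (ContinuousLinearMap.apply ℂ H v).continuous.comp
        (continuous_subtype_val.comp (hΨ.comp (by fun_prop)))
    fun_prop
  refine squeeze_zero (fun _ => norm_nonneg _)
    (fun X => Real.le_sqrt_of_sq_le (Ψ.norm_gvec_sq_le P X v)) ?_
  simpa using h1.tendsto 0

end CPForm

end Gns

/-! ### Completely positive maps satisfy the quadratic form condition -/

section CPFormOfCP

variable {D : Type*} [NonUnitalCStarAlgebra D] [PartialOrder D] [StarOrderedRing D]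
variable {D' : Type*} [NonUnitalCStarAlgebra D'] [PartialOrder D'] [StarOrderedRing D']
variable {A : Type*} [NonUnitalCStarAlgebra A] [PartialOrder A] [StarOrderedRing A]
variable {H : Type*} [NormedAddCommGroup H] [NormedSpace ℂ H] [SMul A H] [CStarModule A H]

theorem map_star_of_cp (Φ : D →CP D') (X : D) : Φ (star X) = star (Φ X) :=
  map_star (PositiveLinearMap.ofClass Φ) X

theorem continuous_of_cp (Φ : D →CP D') : Continuous Φ := map_continuous Φ

/-- The image of a Gram matrix under a completely positive map is again a Gram matrix. -/
theorem exists_gram_of_cp (Φ : D →CP D') {ι : Type*} [Fintype ι] [Nonempty ι] (X : ι → D) :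
    ∃ S : CStarMatrix ι ι D', ∀ i j, Φ (star (X i) * X j) = ∑ k, star (S k i) * S k j := by
  classical
  obtain ⟨i₀⟩ := ‹Nonempty ι›
  -- The square matrix whose only nonzero row is `X`: then `N⋆ N` has the entries `X i⋆ X j`, so
  -- complete positivity applies to it.
  let N : CStarMatrix ι ι D := CStarMatrix.ofMatrix fun k j => if k = i₀ then X j else 0
  have hN (k j : ι) : N k j = if k = i₀ then X j else 0 := rfl
  obtain ⟨S, hS⟩ := exists_eq_star_mul_self_of_nonneg
    (Φ.map_cstarMatrix_nonneg _ (star_mul_self_nonneg N))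
  refine ⟨S, fun i j => ?_⟩
  have h1 : (star N * N) i j = star (X i) * X j := by
    simp [CStarMatrix.mul_apply, CStarMatrix.star_apply, hN]
  have h2 : Φ ((star N * N) i j) = (star S * S) i j := congrFun (congrFun hS i) j
  rw [← h1, h2, CStarMatrix.mul_apply]
  simp only [CStarMatrix.star_apply]

/-- The form of a completely positive map into a C⋆-algebra of adjointable operators. -/
def CPForm.ofCP (Φ : D →CP D') (π : D' →⋆ₙₐ[ℂ] Adjointable A H) : CPForm D A H where
  map := (π : D' →ₗ[ℂ] Adjointable A H) ∘ₗ Φ.toLinearMap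
  map_star X := (congrArg π (map_star_of_cp Φ X)).trans (StarHomClass.map_star π _)
  nonneg s P := by
    change 0 ≤ ∑ i ∈ s, ∑ j ∈ s, inner A i.2
      ((π (Φ (star (P * i.1) * (P * j.1))) : H →L[ℂ] H) j.2)
    rcases s.eq_empty_or_nonempty with rfl | hs
    · simp
    have := hs.to_subtype
    obtain ⟨S, hS⟩ := exists_gram_of_cp Φ fun i : s => P * (i : D × H).1
    have : ∑ i ∈ s, ∑ j ∈ s, inner A i.2
        ((π (Φ (star (P * i.1) * (P * j.1))) : H →L[ℂ] H) j.2) =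
        ∑ k : s, inner A (∑ i : s, (π (S k i) : H →L[ℂ] H) (i : D × H).2)
          (∑ i : s, (π (S k i) : H →L[ℂ] H) (i : D × H).2) := by
      rw [← Finset.sum_coe_sort s]
      simp only [← Finset.sum_coe_sort s (fun j => inner A _ _), hS, map_sum, map_mul,
        StarHomClass.map_star,
        AddSubmonoidClass.coe_finsetSum, sum_apply, MulMemClass.coe_mul, mul_apply_eq_comp,
        CStarModule.inner_sum_right, CStarModule.inner_sum_left, Adjointable.inner_left]
      conv_lhs =>
        enter [2, x]
        rw [Finset.sum_comm]
      rw [Finset.sum_comm]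
      exact Finset.sum_congr rfl fun _ _ => Finset.sum_comm
    rw [this]
    exact Finset.sum_nonneg fun k _ => CStarModule.inner_self_nonneg

end CPFormOfCP

/-! ### Block calculus in the extended linking algebra -/

namespace LinkingAlgebra

variable {C : Type*} [NonUnitalCStarAlgebra C] [PartialOrder C] [StarOrderedRing C]
variable {F : Type*} [NormedAddCommGroup F] [NormedSpace ℂ F] [SMul Cᵐᵒᵖ F] [CStarModule Cᵐᵒᵖ F]
  [CompleteSpace F]

theorem of_mul_of (c c' : C) (y y' z z' : F) (a a' : Adjointable Cᵐᵒᵖ F) :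
    of c y z a * of c' y' z' a' =
      of (c * c' + ip C y z') (op (star c) • y' + ((star a' : Adjointable Cᵐᵒᵖ F) : F →L[ℂ] F) y)
        (op c' • z + (a : F →L[ℂ] F) z') (rankOne C z y' + a * a') :=
  toAdjointableHom_injective (block_mul ..)

theorem star_of (c : C) (y z : F) (a : Adjointable Cᵐᵒᵖ F) :
    star (of c y z a) = of (star c) z y (star a) :=
  toAdjointableHom_injective (star_block ..)

theorem of_add_of (c c' : C) (y y' z z' : F) (a a' : Adjointable Cᵐᵒᵖ F) :
    of c y z a + of c' y' z' a' = of (c + c') (y + y') (z + z') (a + a') :=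
  toAdjointableHom_injective (block_add ..)

theorem smul_of (r : ℂ) (c : C) (y z : F) (a : Adjointable Cᵐᵒᵖ F) :
    r • of c y z a = of (r • c) (star r • y) (r • z) (r • a) :=
  toAdjointableHom_injective (smul_block ..)

theorem rankOne_zero_left (y : F) : rankOne C 0 y = 0 :=
  Subtype.ext (ContinuousLinearMap.ext fun x => map_zero (smulₗ (op (ip C y x)) : F →ₗ[ℂ] F))

theorem rankOne_zero_right (y : F) : rankOne C y 0 = 0 := by
  rw [← star_rankOne, rankOne_zero_left, star_zero]

theorem ip_zero_left (y : F) : ip C 0 y = 0 := by simp [← ipₛₗ_apply]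

theorem ip_zero_right (y : F) : ip C y 0 = 0 := by simp [← ipₛₗ_apply]

theorem op_smul_zero (c : C) : op c • (0 : F) = 0 := map_zero (smulₗ (op c) : F →ₗ[ℂ] F)

theorem zero_smul_zero : (0 : Cᵐᵒᵖ) • (0 : F) = 0 := op_smul_zero 0

theorem zero_op_smul (y : F) : op (0 : C) • y = 0 := map_zero (ket C y)

/-- The upper left corner of the linking algebra. -/
def cornerLeft (c : C) : LinkingAlgebra C F := of c 0 0 0

/-- The lower left corner of the linking algebra. -/
def column (z : F) : LinkingAlgebra C F := of 0 0 z 0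

variable (C F) in
/-- The lower right corner of the linking algebra. -/
def corner : Adjointable Cᵐᵒᵖ F →⋆ₙₐ[ℂ] LinkingAlgebra C F where
  toFun a := of 0 0 0 a
  map_smul' r a := by simp [smul_of]
  map_zero' := by simpa using (smul_of (0 : ℂ) (0 : C) (0 : F) 0 0).symm
  map_add' a b := by simp [of_add_of]
  map_mul' a b := by simp [of_mul_of, rankOne_zero_left, ip_zero_left, zero_smul_zero]
  map_star' a := by simp [star_of]

theorem corner_apply (a : Adjointable Cᵐᵒᵖ F) : corner C F a = of 0 0 0 a := rfl

theorem norm_corner_le (a : Adjointable Cᵐᵒᵖ F) : ‖corner C F a‖ ≤ ‖a‖ :=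
  NonUnitalStarAlgHom.norm_apply_le _ a

end LinkingAlgebra

/-! ### Corners and columns over a unital algebra -/

section Algebra

variable {B : Type*} [CStarAlgebra B] [PartialOrder B] [StarOrderedRing B]
variable {E : Type*} [NormedAddCommGroup E] [NormedSpace ℂ E] [SMul Bᵐᵒᵖ E] [CStarModule Bᵐᵒᵖ E]
  [CompleteSpace E]

theorem op_one_smul (x : E) : op (1 : B) • x = x :=
  ext_inner Bᵐᵒᵖ fun w => by rw [CStarModule.inner_op_smul_right, op_one, one_mul]

theorem one_smul_hilbert (x : E) : (1 : Bᵐᵒᵖ) • x = x := op_one_smul x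

theorem zero_smul_hilbert (x : E) : (0 : Bᵐᵒᵖ) • x = 0 := LinkingAlgebra.zero_op_smul x

theorem smul_zero_hilbert (b : Bᵐᵒᵖ) : b • (0 : E) = 0 := LinkingAlgebra.op_smul_zero (unop b)

namespace LinkingAlgebra

theorem unit_mul (X : LinkingAlgebra B E) : of 1 0 0 1 * X = X := by
  obtain ⟨c, y, z, a, rfl⟩ := X.exists_eq_of
  simp [of_mul_of, ip_zero_left, one_smul_hilbert, smul_zero_hilbert, rankOne_zero_left]

theorem cornerLeft_mul (b c : B) : cornerLeft (F := E) b * cornerLeft c = cornerLeft (b * c) := by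
  simp [cornerLeft, of_mul_of, ip_zero_left, smul_zero_hilbert, rankOne_zero_left]

theorem star_cornerLeft (b : B) : star (cornerLeft (F := E) b) = cornerLeft (star b) := by
  simp [cornerLeft, star_of]

theorem cornerLeft_add (b c : B) : cornerLeft (F := E) (b + c) = cornerLeft b + cornerLeft c := by
  simp [cornerLeft, of_add_of]

theorem cornerLeft_smul (r : ℂ) (c : B) : cornerLeft (F := E) (r • c) = r • cornerLeft c := by
  simp [cornerLeft, smul_of]

/-- This product makes `x ⊙ (X ⊗ v) ↦ x X ⊗ v` isometric; the product in the other order,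
`column_mul_star_column`, places `z y⋆ ⊗ v` in the range of that map. -/
theorem star_column_mul_column (x y : E) :
    star (column (C := B) x) * column y = cornerLeft (ip B x y) := by
  simp [cornerLeft, column, star_of, of_mul_of, smul_zero_hilbert, rankOne_zero_left]

theorem column_mul_star_column (x y : E) :
    column (C := B) x * star (column y) = corner B E (rankOne B x y) := by
  simp [corner_apply, column, star_of, of_mul_of, zero_smul_hilbert, ip_zero_left]

theorem column_mul_cornerLeft_one (x : E) :
    column (C := B) x * cornerLeft 1 = column x := by
  simp [cornerLeft, column, of_mul_of, smul_zero_hilbert, rankOne_zero_right, one_smul_hilbert,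
    ip_zero_left]

theorem corner_one_mul_column (x : E) : corner B E 1 * column x = column x := by
  simp [corner_apply, column, of_mul_of, smul_zero_hilbert, ip_zero_left, rankOne_zero_right]

end LinkingAlgebra

end Algebra

/-! ### The first row of the GNS module as a correspondence -/

section GnsCorrespondence

open LinkingAlgebra InteriorTensor

variable {B : Type*} [CStarAlgebra B] [PartialOrder B] [StarOrderedRing B]
variable {E : Type*} [NormedAddCommGroup E] [NormedSpace ℂ E] [SMul Bᵐᵒᵖ E] [CStarModule Bᵐᵒᵖ E]
  [CompleteSpace E]
variable {A : Type*} [NonUnitalCStarAlgebra A] [PartialOrder A] [StarOrderedRing A]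
variable {H : Type*} [NormedAddCommGroup H] [NormedSpace ℂ H] [SMul A H] [CStarModule A H]

namespace CPForm

variable (Ψ : CPForm (LinkingAlgebra B E) A H)

/-- The left action of `B` on the first row of the GNS module. -/
theorem exists_action : ∃ φ : B →⋆ₙₐ[ℂ] Adjointable A (Ψ.Gns (cornerLeft 1)), ∀ b X v,
    (φ b : Ψ.Gns (cornerLeft 1) →L[ℂ] Ψ.Gns (cornerLeft 1)) (Ψ.gvec _ X v) =
      Ψ.gvec _ (cornerLeft b * X) v := by
  set ι := (Ψ.semiForm (cornerLeft 1)).toHilb with hι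
  let ρ (b : B) : LinkingAlgebra B E ⊗[ℂ] H →ₗ[ℂ] LinkingAlgebra B E ⊗[ℂ] H :=
    (LinearMap.mulLeft ℂ (cornerLeft b : LinkingAlgebra B E)).rTensor H
  have hρ (b : B) (X : LinkingAlgebra B E) (v : H) : ρ b (X ⊗ₜ v) = (cornerLeft b * X) ⊗ₜ v := rfl
  -- The corner entries `b` absorb the cut `cornerLeft 1` on either side, so left multiplication by
  -- `b` is formally adjointable for the cut form.
  have hstar (b : B) (X Y : LinkingAlgebra B E) :
      star (cornerLeft 1 * (cornerLeft b * X)) * (cornerLeft 1 * Y) =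
        star (cornerLeft 1 * X) * (cornerLeft 1 * (cornerLeft (star b) * Y)) := by
    simp only [← mul_assoc, star_mul, star_cornerLeft, star_one]
    simp only [mul_assoc _ (cornerLeft _) (cornerLeft _), cornerLeft_mul, one_mul, mul_one]
  have hadd (d e : B) : ρ (d + e) = ρ d + ρ e := TensorProduct.ext' fun X v => by
    rw [LinearMap.add_apply, hρ, hρ, hρ, cornerLeft_add, add_mul, TensorProduct.add_tmul]
  have hsmul (c : ℂ) (d : B) : ρ (c • d) = c • ρ d := TensorProduct.ext' fun X v => by
    rw [LinearMap.smul_apply, hρ, hρ, cornerLeft_smul, smul_mul_assoc, TensorProduct.smul_tmul']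
  -- `cornerLeft 1 * X` differs from `X` in general; they agree only after the cut, so the unit law
  -- holds in the GNS module but not on the algebraic tensor product.
  have hone : ι ∘ₗ ρ 1 = ι := TensorProduct.ext' fun X v =>
    (congrArg ι (hρ 1 X v)).trans
      (Ψ.gvec_congr _ (by rw [← mul_assoc, cornerLeft_mul, one_mul]) v)
  have hmul (d e : B) : ρ (d * e) = ρ d ∘ₗ ρ e := TensorProduct.ext' fun X v => by
    rw [LinearMap.comp_apply, hρ, hρ, hρ, ← mul_assoc, cornerLeft_mul]
  have hadj (d : B) (s t : LinkingAlgebra B E ⊗[ℂ] H) :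
      Ψ.form (cornerLeft 1) (ρ d s) t = Ψ.form (cornerLeft 1) s (ρ (star d) t) := by
    induction s with
    | zero => simp only [map_zero, LinearMap.zero_apply]
    | add a b ha hb => simp only [map_add, LinearMap.add_apply, ha, hb]
    | tmul X v =>
      induction t with
      | zero => simp only [map_zero]
      | add a b ha hb => simp only [map_add, ha, hb]
      | tmul Y w => rw [hρ, hρ, form_tmul, form_tmul, hstar]
  obtain ⟨φ, hφ⟩ := exists_starHom_of_dense (A := A) (ι := ι) (SemiForm.denseRange_toHilb _) ρ
    (fun d e t => by rw [hadd, LinearMap.add_apply, map_add])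
    (fun c d t => by rw [hsmul, LinearMap.smul_apply, map_smul])
    (fun t => LinearMap.congr_fun hone t) (fun d e t => by rw [hmul, LinearMap.comp_apply])
    (fun d s t => ((Ψ.semiForm (cornerLeft 1)).inner_toHilb _ _).trans
      ((hadj d s t).trans ((Ψ.semiForm (cornerLeft 1)).inner_toHilb _ _).symm))
  exact ⟨φ, fun b X v => hφ b (X ⊗ₜ v)⟩

variable {Ψ} {φ : B →⋆ₙₐ[ℂ] Adjointable A (Ψ.Gns (cornerLeft 1))}

/-- The unit of `B` already fixes every generator, since `cornerLeft 1 * X` and `X` have the same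
first row. -/
theorem nondegenerate_action
    (hφ : ∀ b X v, (φ b : Ψ.Gns (cornerLeft 1) →L[ℂ] Ψ.Gns (cornerLeft 1)) (Ψ.gvec _ X v) =
      Ψ.gvec _ (cornerLeft b * X) v) :
    (Submodule.span ℂ {y | ∃ b x, y = (φ b : Ψ.Gns (cornerLeft 1) →L[ℂ] Ψ.Gns (cornerLeft 1)) x}
      ).topologicalClosure = ⊤ := by
  refine eq_top_iff.2 ((Ψ.total_gvec (cornerLeft 1)).symm.le.trans
    (Submodule.topologicalClosure_mono (Submodule.span_mono ?_)))
  rintro _ ⟨⟨X, v⟩, rfl⟩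
  refine ⟨1, Ψ.gvec _ X v, ?_⟩
  rw [hφ]
  exact Ψ.gvec_congr _ (by rw [← mul_assoc, cornerLeft_mul, one_mul]) v

/-- The tensor product of `E` with the first row of the GNS module embeds into the GNS module. -/
theorem exists_tensor_isometry
    (hφ : ∀ b X v, (φ b : Ψ.Gns (cornerLeft 1) →L[ℂ] Ψ.Gns (cornerLeft 1)) (Ψ.gvec _ X v) =
      Ψ.gvec _ (cornerLeft b * X) v) :
    ∃ J : InteriorTensor E φ →L[ℂ] Ψ.Gns (of 1 0 0 1),
      (∀ x X v, J (tmul φ x (Ψ.gvec _ X v)) = Ψ.gvec _ (column x * X) v) ∧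
      ∀ s t, inner A (J s) (J t) = inner A s t := by
  obtain ⟨J, hJ, hJi⟩ := exists_isometry_of_gram_eq (A := A)
    (total_tmul_of_total E φ (Ψ.total_gvec (cornerLeft 1)))
    (g' := fun p : E × LinkingAlgebra B E × H => Ψ.gvec (of 1 0 0 1) (column p.1 * p.2.1) p.2.2)
    (by
      rintro ⟨x, X, v⟩ ⟨y, Y, w⟩
      simp only
      -- Both inner products are `⟨v, Ψ(X⋆ ⟨x, y⟩ Y) w⟩`: on the tensor side by the definition of
      -- the action, on the GNS side because `x⋆ y = ⟨x, y⟩` in the linking algebra.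
      rw [inner_tmul, hφ, inner_gvec, inner_gvec, unit_mul, unit_mul]
      congr 4
      simp only [← mul_assoc, star_mul, star_cornerLeft, star_one]
      simp only [mul_assoc _ (star (column x)) (column y), star_column_mul_column,
        mul_assoc _ (cornerLeft _) (cornerLeft _), cornerLeft_mul, one_mul])
  exact ⟨J, fun x X v => hJ (x, X, v), hJi⟩

end CPForm

end GnsCorrespondence

/-! ### Lifting through isometries, and the consequence of strictness -/

section OfExtension

open LinkingAlgebra InteriorTensor CPForm

/-- Preimages under an isometry are unique, so choosing them pointwise gives a linear map, and it
inherits the norm bound of `L`. -/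
theorem exists_lift_of_isometry {A : Type*} [NonUnitalCStarAlgebra A] [PartialOrder A]
    [StarOrderedRing A] {F G K : Type*}
    [NormedAddCommGroup F] [NormedSpace ℂ F]
    [NormedAddCommGroup G] [NormedSpace ℂ G] [SMul A G] [CStarModule A G]
    [NormedAddCommGroup K] [NormedSpace ℂ K] [SMul A K] [CStarModule A K] {J : G →L[ℂ] K}
    (hJ : ∀ s t, inner A (J s) (J t) = inner A s t) {L : F →L[ℂ] K}
    (hL : ∀ x, ∃ s, J s = L x) : ∃ ξ : F →L[ℂ] G, ∀ x, J (ξ x) = L x := by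
  have hJn (s : G) : ‖J s‖ = ‖s‖ := norm_eq_of_inner_eq (hJ s s)
  have hinj {s t : G} (h : J s = J t) : s = t := by
    rw [← sub_eq_zero, ← norm_eq_zero, ← hJn, map_sub, h, sub_self, norm_zero]
  choose g hg using hL
  exact ⟨LinearMap.mkContinuous
    { toFun := g
      map_add' := fun x y => hinj (by simp [hg])
      map_smul' := fun c x => hinj (by simp [hg]) } ‖L‖
    fun x => by
      change ‖g x‖ ≤ _
      rw [← hJn, hg]
      exact L.le_opNorm x, hg⟩

theorem isClosed_range_of_isometry {A : Type*} [NonUnitalCStarAlgebra A] [PartialOrder A]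
    [StarOrderedRing A] {G K : Type*}
    [NormedAddCommGroup G] [NormedSpace ℂ G] [SMul A G] [CStarModule A G] [CompleteSpace G]
    [NormedAddCommGroup K] [NormedSpace ℂ K] [SMul A K] [CStarModule A K] {J : G →L[ℂ] K}
    (hJ : ∀ s t, inner A (J s) (J t) = inner A s t) : IsClosed (Set.range J) :=
  (AddMonoidHomClass.isometry_of_norm J fun s =>
    norm_eq_of_inner_eq (hJ s s)).isClosedEmbedding.isClosed_range

variable {B : Type*} [CStarAlgebra B] [PartialOrder B] [StarOrderedRing B]
variable {E : Type*} [NormedAddCommGroup E] [NormedSpace ℂ E] [SMul Bᵐᵒᵖ E] [CStarModule Bᵐᵒᵖ E]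
  [CompleteSpace E]
variable {C : Type*} [NonUnitalCStarAlgebra C] [PartialOrder C] [StarOrderedRing C]
variable {F : Type*} [NormedAddCommGroup F] [NormedSpace ℂ F] [SMul Cᵐᵒᵖ F] [CStarModule Cᵐᵒᵖ F]
  [CompleteSpace F]

variable (Φ : LinkingAlgebra B E →CP LinkingAlgebra C F)

/-- The form of a completely positive map between extended linking algebras. -/
abbrev linkingForm : CPForm (LinkingAlgebra B E) Cᵐᵒᵖ (Column C F) :=
  CPForm.ofCP Φ (toAdjointableHom C F)

theorem continuous_linkingForm_map : Continuous (linkingForm Φ).map :=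
  (continuous_subtype_val.comp (continuous_of_cp Φ) :)

theorem corner_apply_column (a : Adjointable Bᵐᵒᵖ E) (z : Column B E) :
    ((corner B E a).toAdjointable : Column B E →L[ℂ] Column B E) z =
      inr ((a : E →L[ℂ] E) (prr z)) := by
  refine column_ext ?_ ?_
  · change 0 * z.1 + ip B 0 z.2 = 0
    rw [ip_zero_left, zero_mul, zero_add]
  · change op z.1 • (0 : E) + (a : E →L[ℂ] E) z.2 = (a : E →L[ℂ] E) z.2
    rw [smul_zero_hilbert, zero_add]

/-- A strict completely positive map sends the square of the defect of an approximate unit of the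
compact operators to zero. -/
theorem tendsto_map_defect {Φ : LinkingAlgebra B E →CP LinkingAlgebra C F} (hΦ : IsStrict Φ)
    {l : Filter (Adjointable Bᵐᵒᵖ E)} (hl : ∀ᶠ k in l, k ∈ compacts B E ∧ star k = k ∧ ‖k‖ ≤ 1)
    (hx : ∀ x : E, Tendsto (fun k : Adjointable Bᵐᵒᵖ E => (k : E →L[ℂ] E) x) l (𝓝 x)) :
    TendstoStrictly C (fun k => (Φ (corner B E (star (1 - k) * (1 - k)))).toAdjointable) l 0 := by
  have hd : ∀ᶠ k in l, star (1 - k) = 1 - k ∧ ‖1 - k‖ ≤ 2 := by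
    filter_upwards [hl] with k hk
    have h5 : ‖(1 : Adjointable Bᵐᵒᵖ E)‖ ≤ 1 := ContinuousLinearMap.norm_id_le
    exact ⟨by rw [star_sub, star_one, hk.2.1], (norm_sub_le _ _).trans (by linarith [hk.2.2])⟩
  have hb : ∀ᶠ k in l, ‖corner B E (star (1 - k) * (1 - k))‖ ≤ 4 := by
    filter_upwards [hd] with k hk
    refine (norm_corner_le _).trans ((norm_mul_le _ _).trans ?_)
    rw [hk.1]
    nlinarith [norm_nonneg (1 - k), hk.2]
  have hz (x : E) : Tendsto (fun k : Adjointable Bᵐᵒᵖ E =>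
      ((star (1 - k) * (1 - k) : Adjointable Bᵐᵒᵖ E) : E →L[ℂ] E) x) l (𝓝 0) := by
    have h1 : Tendsto (fun k : Adjointable Bᵐᵒᵖ E => 2 * ‖(k : E →L[ℂ] E) x - x‖) l (𝓝 0) := by
      simpa using (tendsto_iff_norm_sub_tendsto_zero.1 (hx x)).const_mul 2
    refine squeeze_zero_norm' ?_ h1
    filter_upwards [hd] with k hk
    rw [hk.1]
    have h2 : ‖((1 - k : Adjointable Bᵐᵒᵖ E) : E →L[ℂ] E) x‖ = ‖(k : E →L[ℂ] E) x - x‖ :=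
      norm_sub_rev x _
    exact (((1 - k : Adjointable Bᵐᵒᵖ E) : E →L[ℂ] E).le_opNorm _).trans
      (mul_le_mul hk.2 h2.le (norm_nonneg _) zero_le_two)
  have hzc (z : Column B E) : Tendsto (fun k : Adjointable Bᵐᵒᵖ E =>
      ((corner B E (star (1 - k) * (1 - k))).toAdjointable : Column B E →L[ℂ] Column B E) z) l
        (𝓝 0) := by
    simp only [corner_apply_column]
    have := (inr (C := B) (F := E)).continuous.tendsto 0 |>.comp (hz (prr z))
    rwa [map_zero] at this
  have hs : TendstoStrictly B (fun k => (corner B E (star (1 - k) * (1 - k))).toAdjointable) l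
      (LinkingAlgebra.toAdjointable 0) := by
    refine tendstoStrictly_of_pointwise (M := 4) hb hzc fun z => ?_
    have : star (LinkingAlgebra.toAdjointable (0 : LinkingAlgebra B E)) = 0 := star_zero _
    rw [this]
    -- The squared defects are self-adjoint, so pointwise convergence of the adjoints is the
    -- convergence already shown.
    have h1 (k : Adjointable Bᵐᵒᵖ E) : star (corner B E (star (1 - k) * (1 - k))).toAdjointable =
        (corner B E (star (1 - k) * (1 - k))).toAdjointable := by
      change (star (corner B E (star (1 - k) * (1 - k)))).toAdjointable = _
      rw [← StarHomClass.map_star, star_mul, star_star]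
    simp only [h1]
    exact hzc z
  -- Strictness speaks of filters on the linking algebra, so `l` is pushed forward to it and the
  -- conclusion pulled back.
  have := hΦ (l.map fun k => corner B E (star (1 - k) * (1 - k))) 0 ⟨4, hb⟩
    (fun k hk => by simpa only [tendsto_map'_iff] using! hs k hk)
  rw [map_zero] at this
  exact fun k hk => by simpa only [tendsto_map'_iff] using! this k hk

end OfExtension

/-! ### The unit vectors lie in the tensor product -/

section GnsLift

open LinkingAlgebra InteriorTensor CPForm

variable {B : Type*} [CStarAlgebra B] [PartialOrder B] [StarOrderedRing B]
variable {E : Type*} [NormedAddCommGroup E] [NormedSpace ℂ E] [SMul Bᵐᵒᵖ E] [CStarModule Bᵐᵒᵖ E]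
  [CompleteSpace E]
variable {C : Type*} [NonUnitalCStarAlgebra C] [PartialOrder C] [StarOrderedRing C]
variable {H : Type*} [NormedAddCommGroup H] [NormedSpace ℂ H] [SMul Cᵐᵒᵖ H] [CStarModule Cᵐᵒᵖ H]
  [CompleteSpace H]
variable {Ψ : CPForm (LinkingAlgebra B E) Cᵐᵒᵖ H} {u : LinkingAlgebra B E}

/-- The vector `k ⊗ v` depends linearly and continuously on `k`, so membership passes from rank-one
operators to their closed span. -/
theorem gvec_corner_mem_of_compact (hc : Continuous Ψ.map) {W : Submodule ℂ (Ψ.Gns u)}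
    (hW : IsClosed (W : Set (Ψ.Gns u)))
    (h : ∀ (z y : E) v, Ψ.gvec u (corner B E (rankOne B z y)) v ∈ W) (v : H)
    {k : Adjointable Bᵐᵒᵖ E} (hk : k ∈ compacts B E) : Ψ.gvec u (corner B E k) v ∈ W := by
  let f : Adjointable Bᵐᵒᵖ E →ₗ[ℂ] Ψ.Gns u :=
    (Ψ.gvecₗ u).flip v ∘ₗ (corner B E : Adjointable Bᵐᵒᵖ E →ₗ[ℂ] LinkingAlgebra B E)
  have hf : Continuous f :=
    (Ψ.continuous_gvec_left u hc v).comp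
      (AddMonoidHomClass.continuous_of_bound (corner B E) 1 fun a => by
        rw [one_mul]; exact norm_corner_le a)
  refine Submodule.topologicalClosure_minimal (t := W.comap f) _ (Submodule.span_le.2 ?_)
    (hW.preimage hf) hk
  rintro _ ⟨z, y, rfl⟩
  exact h z y v

/-- Up to sign the difference is `(1 - k) ⊗ w`, whose square is governed by `Ψ((1 - k)⋆ (1 - k)) w`.
This is the quantity that strictness sends to zero. -/
theorem norm_gvec_sub_sq_le (hu : ∀ X, u * X = X) (k : Adjointable Bᵐᵒᵖ E) (w : H) :
    ‖Ψ.gvec u (corner B E k) w - Ψ.gvec u (corner B E 1) w‖ ^ 2 ≤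
      ‖w‖ * ‖(Ψ.map (corner B E (star (1 - k) * (1 - k))) : H →L[ℂ] H) w‖ := by
  have h3 := Ψ.norm_gvec_sq_le u (corner B E (1 - k)) w
  rw [hu, ← StarHomClass.map_star, ← map_mul] at h3
  have h4 : Ψ.gvec u (corner B E (1 - k)) w =
      Ψ.gvec u (corner B E 1) w - Ψ.gvec u (corner B E k) w := by
    rw [map_sub]
    exact LinearMap.map_sub₂ (Ψ.gvecₗ u) _ _ _
  rwa [norm_sub_rev, ← h4]

variable (Ψ) in
/-- Strictness, in terms of an approximate unit of the compact operators. -/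
def CPForm.HasDefect : Prop :=
  ∃ l : Filter (Adjointable Bᵐᵒᵖ E), l.NeBot ∧ (∀ᶠ k in l, k ∈ compacts B E) ∧
    TendstoStrictly C (fun k => Ψ.map (corner B E (star (1 - k) * (1 - k)))) l 0

/-- A closed subspace of the GNS module which contains the vectors `z y⋆ ⊗ v` contains the vectors
`1 ⊗ v`. -/
theorem gvec_corner_one_mem (hc : Continuous Ψ.map) (hΨ : Ψ.HasDefect) (hu : ∀ X, u * X = X)
    {W : Submodule ℂ (Ψ.Gns u)} (hW : IsClosed (W : Set (Ψ.Gns u)))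
    (h : ∀ (z y : E) v, Ψ.gvec u (corner B E (rankOne B z y)) v ∈ W)
    (v : H) : Ψ.gvec u (corner B E 1) v ∈ W := by
  obtain ⟨l, hl0, hl, hdef⟩ := hΨ
  obtain ⟨m, hm0, hm, hmx⟩ := exists_approximateUnit_compacts (C := C) (F := H)
  -- Strict convergence to zero gives convergence on vectors `k' v` with `k'` compact on `H`. The
  -- limit in `k` is therefore taken at such vectors first; afterwards `k' v → v` along an
  -- approximate unit of the compacts of `H`.
  have key {k' : Adjointable Cᵐᵒᵖ H} (hk' : k' ∈ compacts C H) :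
      Ψ.gvec u (corner B E 1) ((k' : H →L[ℂ] H) v) ∈ W := by
    set w := (k' : H →L[ℂ] H) v
    refine hW.mem_of_tendsto (b := l) (f := fun k => Ψ.gvec u (corner B E k) w) ?_
      (hl.mono fun k hk => gvec_corner_mem_of_compact hc hW h w hk)
    have h1 : Tendsto (fun k => (Ψ.map (corner B E (star (1 - k) * (1 - k))) : H →L[ℂ] H) w) l
      (𝓝 0) := hdef.apply hk' v
    have h2 : Tendsto (fun k =>
        √(‖w‖ * ‖(Ψ.map (corner B E (star (1 - k) * (1 - k))) : H →L[ℂ] H) w‖)) l (𝓝 0) := by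
      simpa using (h1.norm.const_mul ‖w‖).sqrt
    rw [tendsto_iff_norm_sub_tendsto_zero]
    exact squeeze_zero (fun _ => norm_nonneg _)
      (fun k => Real.le_sqrt_of_sq_le (norm_gvec_sub_sq_le hu k w)) h2
  exact hW.mem_of_tendsto (((Ψ.continuous_gvec_right u (corner B E 1)).tendsto v).comp (hmx v))
    (hm.mono fun k' hk' => key hk'.1)

/-- The operator `v ↦ 1 ⊗ v`, as an adjointable operator into the tensor product of `E` with the
first row of the GNS module. -/
theorem exists_gns_lift (hc : Continuous Ψ.map) (hΨ : Ψ.HasDefect)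
    {φ : B →⋆ₙₐ[ℂ] Adjointable Cᵐᵒᵖ (Ψ.Gns (cornerLeft 1))}
    (hφ : ∀ b X v, (φ b : Ψ.Gns (cornerLeft 1) →L[ℂ] Ψ.Gns (cornerLeft 1)) (Ψ.gvec _ X v) =
      Ψ.gvec _ (cornerLeft b * X) v) :
    ∃ (ξ : H →L[ℂ] InteriorTensor E φ) (ξ' : InteriorTensor E φ →L[ℂ] H),
      IsAdjointPair Cᵐᵒᵖ ξ ξ' ∧
      ∀ x X v, ξ' (tmul φ x (Ψ.gvec _ X v)) = (Ψ.map (column x * X) : H →L[ℂ] H) v := by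
  obtain ⟨J, hJ, hJi⟩ := exists_tensor_isometry hφ
  -- The vector `z y⋆ ⊗ v` is the image of `z ⊙ (y⋆ ⊗ v)`, so the closed range contains `1 ⊗ v`.
  have hrange (v : H) : ∃ s, J s = Ψ.gvec (of 1 0 0 1) (corner B E 1) v := by
    refine gvec_corner_one_mem hc hΨ unit_mul
      (W := LinearMap.range (J : InteriorTensor E φ →ₗ[ℂ] Ψ.Gns (of 1 0 0 1)))
      (isClosed_range_of_isometry hJi) ?_ v
    intro z y v
    refine ⟨tmul φ z (Ψ.gvec _ (star (column y)) v), ?_⟩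
    rw [← column_mul_star_column]
    exact hJ _ _ _
  let L : H →L[ℂ] Ψ.Gns (of 1 0 0 1) :=
    ⟨Ψ.gvecₗ (of 1 0 0 1) (corner B E 1), Ψ.continuous_gvec_right _ _⟩
  obtain ⟨ξ, hξ⟩ := exists_lift_of_isometry hJi (L := L) hrange
  have hin (y : H) (x : E) (X : LinkingAlgebra B E) (v : H) :
      inner Cᵐᵒᵖ (ξ y) (tmul φ x (Ψ.gvec _ X v)) =
        inner Cᵐᵒᵖ y ((Ψ.map (column x * X) : H →L[ℂ] H) v) := by
    rw [← hJi, hξ, hJ]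
    refine (Ψ.inner_gvec _ _ _ _ _).trans ?_
    -- The unit of the lower right corner fixes `x`, hence `⟨1 ⊗ y, x X ⊗ v⟩ = ⟨y, Ψ(x X) v⟩`.
    rw [unit_mul, unit_mul, ← StarHomClass.map_star, star_one, ← mul_assoc, corner_one_mul_column]
  obtain ⟨ξ', hadj⟩ := exists_adjoint_of_total (total_tmul_of_total E φ
    (Ψ.total_gvec (cornerLeft 1))) ξ (by
      rintro _ ⟨⟨x, X, v⟩, rfl⟩
      exact ⟨_, fun y => hin y x X v⟩)
  exact ⟨ξ, ξ', hadj, fun x X v => ext_inner Cᵐᵒᵖ fun y => by rw [← hadj, hin]⟩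

end GnsLift

/-! ### The vector `ξ₁` and the factorization of `T` -/

section Factorization

open LinkingAlgebra InteriorTensor CPForm

variable {B : Type*} [CStarAlgebra B] [PartialOrder B] [StarOrderedRing B]
variable {E : Type*} [NormedAddCommGroup E] [NormedSpace ℂ E] [SMul Bᵐᵒᵖ E] [CStarModule Bᵐᵒᵖ E]
  [CompleteSpace E]
variable {C : Type*} [NonUnitalCStarAlgebra C] [PartialOrder C] [StarOrderedRing C]
variable {F : Type*} [NormedAddCommGroup F] [NormedSpace ℂ F] [SMul Cᵐᵒᵖ F] [CStarModule Cᵐᵒᵖ F]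
  [CompleteSpace F]

/-- The vectors `p ⊗ (e, 0)` converge along an approximate unit of `C`. -/
theorem exists_tendsto_gvec_inl (Ψ : CPForm (LinkingAlgebra B E) Cᵐᵒᵖ (Column C F))
    (X : LinkingAlgebra B E) {c : C} {y z : F}
    {a : Adjointable Cᵐᵒᵖ F} {P : LinkingAlgebra B E}
    (hX : Ψ.map (star (P * X) * (P * X)) = block c y z a) {l : Filter C}
    (hl : l.IsIncreasingApproximateUnit) :
    ∃ ξ, Tendsto (fun e : C => Ψ.gvec P X (inl e)) l (𝓝 ξ) := by
  have := hl.neBot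
  have hsub (d e : C) : Ψ.gvec P X (inl d) - Ψ.gvec P X (inl e) = Ψ.gvec P X (inl (d - e)) := by
    rw [map_sub]
    exact (map_sub (Ψ.gvecₗ P X) _ _).symm
  -- Only the upper left corner `c` of the block matters on `(d, 0)`: the squared norm is that of
  -- `d⋆ c d`. The factor `c d` becomes small for differences `d` of elements of the approximate
  -- unit.
  have hn (d : C) : ‖Ψ.gvec P X (inl d)‖ ^ 2 ≤ ‖d‖ * ‖c * d‖ := by
    rw [CStarModule.norm_sq_eq Cᵐᵒᵖ, inner_gvec]
    have h1 : ip C (inl (F := F) d)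
        ((block c y z a : Column C F →L[ℂ] Column C F) (inl d)) = star d * (c * d) := by
      rw [ip_column]
      change star d * (c * d + ip C y 0) + ip C (0 : F) _ = _
      rw [ip_zero_left, ip_zero_right, add_zero, add_zero]
    rw [hX]
    refine (congrArg norm h1).trans_le ((norm_mul_le _ _).trans ?_)
    rw [norm_star]
  refine cauchy_map_iff_exists_tendsto.1 (Metric.cauchy_iff.2 ⟨hl.neBot.map _, fun ε hε => ?_⟩)
  -- The constant `ε² / 8` gives `‖c (d - e)‖ < ε² / 4`; with `‖d - e‖ ≤ 2` the squared distance
  -- stays below `ε² / 2`.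
  have hev : ∀ᶠ e in l, ‖e‖ ≤ 1 ∧ ‖c * e - c‖ < ε ^ 2 / 8 := by
    filter_upwards [hl.eventually_norm, (Metric.tendsto_nhds.1 (hl.tendsto_mul_left c)) (ε ^ 2 / 8)
      (by positivity)] with e h1 h2
    exact ⟨h1, by rwa [← dist_eq_norm]⟩
  refine ⟨_, image_mem_map hev, ?_⟩
  rintro _ ⟨d, hd, rfl⟩ _ ⟨e, he, rfl⟩
  rw [dist_eq_norm, hsub]
  have h1 : ‖d - e‖ ≤ 2 := (norm_sub_le _ _).trans (by linarith [hd.1, he.1])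
  have h2 : ‖c * (d - e)‖ < ε ^ 2 / 4 := by
    have : c * (d - e) = (c * d - c) - (c * e - c) := by rw [mul_sub]; abel
    rw [this]
    exact (norm_sub_le _ _).trans_lt (by linarith [hd.2, he.2])
  refine lt_of_pow_lt_pow_left₀ 2 hε.le ((hn (d - e)).trans_lt ?_)
  nlinarith [norm_nonneg (c * (d - e)), norm_nonneg (d - e)]

theorem isAdjointPair_inr : IsAdjointPair Cᵐᵒᵖ (inr : F →L[ℂ] Column C F) prr :=
  isAdjointPair_iff.2 fun x v => by
    change star (0 : C) * v.1 + ip C x v.2 = ip C x v.2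
    rw [star_zero, zero_mul, zero_add]

theorem IsAdjointPair.comp {A : Type*} [NonUnitalCStarAlgebra A] [PartialOrder A]
    [StarOrderedRing A] {F G K : Type*}
    [NormedAddCommGroup F] [NormedSpace ℂ F] [SMul A F] [CStarModule A F]
    [NormedAddCommGroup G] [NormedSpace ℂ G] [SMul A G] [CStarModule A G]
    [NormedAddCommGroup K] [NormedSpace ℂ K] [SMul A K] [CStarModule A K]
    {a : F →L[ℂ] G} {a' : G →L[ℂ] F} {b : G →L[ℂ] K} {b' : K →L[ℂ] G}
    (hb : IsAdjointPair A b b') (ha : IsAdjointPair A a a') :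
    IsAdjointPair A (b ∘L a) (a' ∘L b') := fun _ _ => (hb _ _).trans (ha _ _)

theorem hasDefect_of_isStrict {Φ : LinkingAlgebra B E →CP LinkingAlgebra C F}
    (hΦ : IsStrict Φ) : (linkingForm Φ).HasDefect := by
  obtain ⟨l, hl0, hl, hlx⟩ := exists_approximateUnit_compacts (C := B) (F := E)
  exact ⟨l, hl0, hl.mono fun k hk => hk.1, tendsto_map_defect hΦ hl hlx⟩

/-- Tested against `y`, the convergence of `x e` to `x` becomes `⟨y, x⟩ e → ⟨y, x⟩` in `C`. This
weak form suffices to identify limits. -/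
theorem tendsto_op_smul {l : Filter C} (hl : l.IsIncreasingApproximateUnit) (x y : F) :
    Tendsto (fun e : C => ip C y (op e • x)) l (𝓝 (ip C y x)) := by
  simp only [ip_smul_right]
  exact hl.tendsto_mul_left _

theorem prr_block_inl (c : C) (y z : F) (a : Adjointable Cᵐᵒᵖ F) (e : C) :
    prr ((block c y z a : Column C F →L[ℂ] Column C F) (inl e)) = op e • z := by
  change op e • z + (a : F →L[ℂ] F) 0 = op e • z
  rw [map_zero, add_zero]

theorem continuous_tmul_right {A G : Type*} [NonUnitalCStarAlgebra A] [PartialOrder A]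
    [StarOrderedRing A] [NormedAddCommGroup G] [NormedSpace ℂ G] [SMul A G] [CStarModule A G]
    (φ : B →⋆ₙₐ[ℂ] Adjointable A G) (x : E) : Continuous (tmul φ x) :=
  AddMonoidHomClass.continuous_of_bound (tmulₗ φ x) _ (norm_tmul_le φ x)

/-- A bounded operator is determined on `x ⊙ ξ` by its values on `x ⊙ ξ_e` if `ξ_e → ξ`. -/
theorem eq_of_tendsto_tmul {G : Type*} [NormedAddCommGroup G] [NormedSpace ℂ G] [SMul Cᵐᵒᵖ G]
    [CStarModule Cᵐᵒᵖ G] {φ : B →⋆ₙₐ[ℂ] Adjointable Cᵐᵒᵖ G} {V : InteriorTensor E φ →L[ℂ] F}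
    {l : Filter C} (hl : l.IsIncreasingApproximateUnit) {g : C → G} {ξ : G}
    (hg : Tendsto g l (𝓝 ξ)) {x : E} {y : F} (h : ∀ e, V (tmul φ x (g e)) = op e • y) :
    y = V (tmul φ x ξ) := by
  have := hl.neBot
  have hlim : Tendsto (fun e => V (tmul φ x (g e))) l (𝓝 (V (tmul φ x ξ))) :=
    ((V.continuous.comp (continuous_tmul_right φ x)).tendsto ξ).comp hg
  simp only [h] at hlim
  refine ext_inner Cᵐᵒᵖ fun w => unop_injective ?_
  exact tendsto_nhds_unique (tendsto_op_smul hl y w) (((bra C w).continuous.tendsto _).comp hlim)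

set_option maxHeartbeats 1000000 in
/-- A strict completely positive block-wise extension of `T` yields the factorization
`T x = ξ₂⋆ (x ⊙ ξ₁)`. -/
theorem exists_factorization {Ψ : CPForm (LinkingAlgebra B E) Cᵐᵒᵖ (Column C F)}
    (hc : Continuous Ψ.map) (hΨ : Ψ.HasDefect) {T : E → F} {τ : B → C}
    {θ : Adjointable Bᵐᵒᵖ E → Adjointable Cᵐᵒᵖ F}
    (hT : ∀ (b : B) (x' x : E) (a : Adjointable Bᵐᵒᵖ E),
      Ψ.map (of b x' x a) = block (τ b) (T x') (T x) (θ a))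
    {φ : B →⋆ₙₐ[ℂ] Adjointable Cᵐᵒᵖ (Ψ.Gns (cornerLeft 1))}
    (hφ : ∀ b X v, (φ b : Ψ.Gns (cornerLeft 1) →L[ℂ] Ψ.Gns (cornerLeft 1)) (Ψ.gvec _ X v) =
      Ψ.gvec _ (cornerLeft b * X) v) :
    ∃ (ξ₁ : Ψ.Gns (cornerLeft 1)) (ξ₂ : F →L[ℂ] InteriorTensor E φ)
      (ξ₂' : InteriorTensor E φ →L[ℂ] F), IsAdjointPair Cᵐᵒᵖ ξ₂ ξ₂' ∧
        ∀ x : E, T x = ξ₂' (tmul φ x ξ₁) := by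
  obtain ⟨ξ, ξ', hξ, hξ'⟩ := exists_gns_lift hc hΨ hφ
  have hl := CStarAlgebra.increasingApproximateUnit C
  -- The projection `cornerLeft 1` serves both as the cut and as the generator, so the block whose
  -- upper left corner controls convergence is `Ψ(cornerLeft 1)`.
  have hp : Ψ.map (star (cornerLeft 1 * cornerLeft 1) * (cornerLeft 1 * cornerLeft 1)) =
      block (τ 1) (T 0) (T 0) (θ 0) := by
    simp only [star_cornerLeft, star_one, cornerLeft_mul, one_mul]
    exact hT 1 0 0 0
  obtain ⟨ξ₁, hξ₁⟩ := exists_tendsto_gvec_inl Ψ (cornerLeft 1) hp hl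
  refine ⟨ξ₁, ξ ∘L inr, prr ∘L ξ', hξ.comp isAdjointPair_inr, fun x => ?_⟩
  refine eq_of_tendsto_tmul hl hξ₁ fun e => ?_
  -- At the approximating vectors the adjoint gives `Ψ(column x) (e, 0)`, whose component in `F` is
  -- `T(x) e`; letting `e` run through the approximate unit yields `T(x)`.
  refine (congrArg prr (hξ' x (cornerLeft 1) (inl e))).trans ?_
  rw [column_mul_cornerLeft_one, column, hT]
  exact prr_block_inl _ _ _ _ _

end Factorization

end HilbertModule

end

open HilbertModule
open scoped CStarAlgebra
theorem mainTheorem3 {B : Type u} [CStarAlgebra B] [PartialOrder B] [StarOrderedRing B]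
    {C : Type v} [NonUnitalCStarAlgebra C] [PartialOrder C] [StarOrderedRing C]
    {E : Type w} [NormedAddCommGroup E] [NormedSpace ℂ E] [SMul Bᵐᵒᵖ E] [CStarModule Bᵐᵒᵖ E]
    [CompleteSpace E]
    {F : Type z} [NormedAddCommGroup F] [NormedSpace ℂ F] [SMul Cᵐᵒᵖ F] [CStarModule Cᵐᵒᵖ F]
    [CompleteSpace F]
    (T : E → F) :
    (∃ (τ : B → C) (θ : Adjointable Bᵐᵒᵖ E → Adjointable Cᵐᵒᵖ F)
        (Φ : LinkingAlgebra B E →CP LinkingAlgebra C F),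
        IsStrict Φ ∧ ∀ (b : B) (x' x : E) (a : Adjointable Bᵐᵒᵖ E),
          Φ (LinkingAlgebra.of b x' x a) = LinkingAlgebra.of (τ b) (T x') (T x) (θ a)) ↔
      ∃ (𝔉 : Correspondence.{u, v, max u v w z} B C) (ξ₁ : 𝔉.carrier)
        (ξ₂ : F →L[ℂ] InteriorTensor E 𝔉.action) (ξ₂' : InteriorTensor E 𝔉.action →L[ℂ] F),
        IsAdjointPair Cᵐᵒᵖ ξ₂ ξ₂' ∧ ∀ x : E, T x = ξ₂' (InteriorTensor.tmul 𝔉.action x ξ₁) := by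
  constructor
  · rintro ⟨τ, θ, Φ, hΦ, hT⟩
    obtain ⟨φ, hφ⟩ := (linkingForm Φ).exists_action
    obtain ⟨ξ₁, ξ₂, ξ₂', h, hξ⟩ := exists_factorization (continuous_linkingForm_map Φ)
      (hasDefect_of_isStrict hΦ) (fun b x' x a => congrArg LinkingAlgebra.toAdjointable
        (hT b x' x a)) hφ
    exact ⟨⟨_, φ, CPForm.nondegenerate_action hφ⟩, ξ₁, ξ₂, ξ₂', h, hξ⟩
  · rintro ⟨𝔉, ξ₁, ξ₂, ξ₂', h, hξ⟩
    obtain ⟨τ, θ, Φ, hΦ, hT⟩ := exists_cp_extension 𝔉.action ξ₁ h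
    exact ⟨τ, θ, Φ, hΦ, fun b x' x a => by rw [hT, ← hξ, ← hξ]⟩
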